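/- Let $\Psi$ be the set of all increasing (that is, non-decreasing) continuous concave functions $\psi$ on $[0,1]$ with $\psi(0)=0$ that are not identically zero. For $\psi\in\Psi$ and a measurable real function $x$ on a probability space $(\Omega,P)$ put $$\|x\|_{\Lambda(\psi)}=\int_0^1 x^*(t)\,d\psi(t),\qquad x^*(t)=\inf\{s\ge 0 : P(|x|>s)\le t\},$$ and let $\Lambda(\psi)(\Omega)$ be the Lorentz space of all (classes of) such $x$ with $\|x\|_{\Lambda(\psi)}<\infty$. Let $r$ be a centered Bernoulli random variable on $[0,1]$, taking the values $\pm1$ with probability $\frac12$ each. For $n\ge1$ let $A_n$ be the linear operator which sends a function $f\in\Lambda(\psi)([0,1])$ to the function $$(A_nf)(s_1,t_1,\dots,s_n,t_n)=\sum_{i=1}^n f(s_i)\,r(t_i)$$ on $[0,1]^{2n}$ (with Lebesgue measure), and let $\|A_n\|_{\mathcal L(\Lambda(\psi))}$ be its norm as an operator from $\Lambda(\psi)([0,1])$ to $\Lambda(\psi)([0,1]^{2n})$. Theorem. Let $\psi\in\Psi$. The following conditions are equivalent. (i) $\|A_n\|_{\mathcal L(\Lambda(\psi))}<n$ for all sufficiently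 large $n$. (ii) There are integers $k\ge2$ and $l\ge2$ such that $$\limsup_{u\to0+}\frac{\psi(ku)}{\psi(u)}<k\qquad\text{and}\qquad\limsup_{u\to0+}\frac{\psi(u^l)}{\psi(u)}<1.$$ -/

import Mathlib

open MeasureTheory Filter Topology Set
open scoped ENNReal unitInterval

/-- The class `Ψ`: increasing (in the wide sense) continuous concave functions on `[0,1]` that
vanish at `0`, and are not identically zero, so that `Λ(ψ)` carries a norm (for an increasing
function with `ψ 0 = 0`, not being identically zero on `[0,1]` means `ψ 1 > 0`).
The values of the function outside `[0,1]` are irrelevant. -/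
structure PsiClass where
  toFun : ℝ → ℝ
  monotoneOn : MonotoneOn toFun (Icc 0 1)
  continuousOn : ContinuousOn toFun (Icc 0 1)
  concaveOn : ConcaveOn ℝ (Icc 0 1) toFun
  map_zero : toFun 0 = 0
  map_one_pos : 0 < toFun 1

instance : CoeFun PsiClass (fun _ => ℝ → ℝ) := ⟨PsiClass.toFun⟩

/-- `ψ` as a Stieltjes function on `ℝ`: extended by `0` to the left of `[0,1]` and by `ψ 1` to the
right of it. -/
noncomputable def PsiClass.stieltjes (ψ : PsiClass) : StieltjesFunction ℝ where
  toFun := fun t => ψ (projIcc (0 : ℝ) 1 zero_le_one t)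
  mono' := fun _ _ hst => ψ.monotoneOn (projIcc (0 : ℝ) 1 zero_le_one _).2
    (projIcc (0 : ℝ) 1 zero_le_one _).2 (monotone_projIcc zero_le_one hst)
  right_continuous' := fun _ => by
    have h : Continuous (fun t : ℝ => ψ (projIcc (0 : ℝ) 1 zero_le_one t)) :=
      ψ.continuousOn.comp_continuous (continuous_subtype_val.comp continuous_projIcc)
        (fun t => (projIcc (0 : ℝ) 1 zero_le_one t).2)
    exact h.continuousWithinAt

/-- The non-increasing right-continuous rearrangement
`x^*(t) = inf {s ≥ 0 : P(|x| > s) ≤ t}` of a function `x` on a measure space, with values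
in `[0,∞]`. -/
noncomputable def decreasingRearrangement {X : Type*} [MeasurableSpace X] (P : Measure X)
    (x : X → ℝ) (t : ℝ) : ℝ≥0∞ :=
  sInf {s : ℝ≥0∞ | P {ω | s < ‖x ω‖ₑ} ≤ ENNReal.ofReal t}

/-- The Lorentz norm `‖x‖_{Λ(ψ)} = ∫_0^1 x^*(t) dψ(t)` (a Lebesgue–Stieltjes integral) of a
function on a probability space, with the value `∞` allowed. -/
noncomputable def lorentzNorm (ψ : PsiClass) {X : Type*} [MeasurableSpace X] (P : Measure X)
    (x : X → ℝ) : ℝ≥0∞ :=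
  ∫⁻ t in Ioc (0 : ℝ) 1, decreasingRearrangement P x t ∂ψ.stieltjes.measure

/-- The Lorentz space `Λ(ψ)` over a probability space (representatives of the a.e. classes). -/
def lorentzSpace (ψ : PsiClass) {X : Type*} [MeasurableSpace X] (P : Measure X) :
    Set (X → ℝ) :=
  {x | AEMeasurable x P ∧ lorentzNorm ψ P x < ∞}

/-- The centered Bernoulli random variable on `[0,1]`: it takes each of the values `1` and `-1`
with probability `1/2`. -/
noncomputable def bernoulliSign (t : I) : ℝ := if (t : ℝ) ≤ 1 / 2 then 1 else -1

/-- `A_n f = (f ⊗ r)_1 + ⋯ + (f ⊗ r)_n` as a function on `([0,1] × [0,1])^n`: the `i`-th summand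
is `f ⊗ r` in the `i`-th pair of variables. -/
noncomputable def operatorA (n : ℕ) (f : I → ℝ) : (Fin n → I × I) → ℝ :=
  fun ω => ∑ i, f (ω i).1 * bernoulliSign (ω i).2

/-- The norm of `A_n` as an operator from `Λ(ψ)` over `[0,1]` to `Λ(ψ)` over `([0,1] × [0,1])^n`
(all with Lebesgue product measure): the least `C ∈ [0,∞]` with `‖A_n f‖ ≤ C ‖f‖` for all
`f ∈ Λ(ψ)`. -/
noncomputable def operatorANorm (ψ : PsiClass) (n : ℕ) : ℝ≥0∞ :=
  sInf {C : ℝ≥0∞ | ∀ f ∈ lorentzSpace ψ (volume : Measure I),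
    lorentzNorm ψ (volume : Measure (Fin n → I × I)) (operatorA n f)
      ≤ C * lorentzNorm ψ (volume : Measure I) f}

/-! Only indicators matter. For a sign-valued function whose support has measure `u`, the modulus of
its image under `A_n` is at least `j` with probability `tailProb n j u`, so its norm is the sum of
`ψ (tailProb n j u)` over `1 ≤ j ≤ n`. A general function is a limit of sums `δ ∑ h_i` of truncated
signs, and subadditivity of the Choquet integral of `ψ ∘ P` carries a bound for signs over to it.
Hence the norm of `A_n` is the supremum over `u` of that sum divided by `ψ u`
(`exists_lt_of_operatorANorm_lt`, `operatorANorm_le`).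

For fixed `u > 0` the ratio is below `n` once `n` is large, uniformly in `u` (`sum_map_tailProb_lt`:
Jensen plus cancellation of signs), and it is continuous, so only `u → 0` can spoil the strict
inequality. There the first tail is about `n u`, which is governed by the dilation condition; the
others lie between `(u/2)^n` and `3^n u^j`, which are governed by the power condition. -/

namespace PsiClass

variable (ψ : PsiClass)

/-! ### Concavity estimates for `ψ`. -/

theorem mono {a b : ℝ} (ha : 0 ≤ a) (hab : a ≤ b) (hb : b ≤ 1) : ψ a ≤ ψ b :=
  ψ.monotoneOn ⟨ha, hab.trans hb⟩ ⟨ha.trans hab, hb⟩ hab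

theorem nonneg {a : ℝ} (ha : 0 ≤ a) (ha' : a ≤ 1) : 0 ≤ ψ a := by
  simpa [ψ.map_zero] using ψ.mono le_rfl ha ha'

theorem mul_le_map_mul {a t : ℝ} (ha : 0 ≤ a) (ha' : a ≤ 1) (ht : 0 ≤ t) (ht' : t ≤ 1) :
    a * ψ t ≤ ψ (a * t) := by
  have := ψ.concaveOn.2 ⟨le_rfl, zero_le_one⟩ ⟨ht, ht'⟩
    (sub_nonneg.2 ha') ha (by ring)
  simpa [ψ.map_zero] using this

theorem map_mul_le_mul {a t : ℝ} (ha : 1 ≤ a) (ht : 0 ≤ t) (hat : a * t ≤ 1) :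
    ψ (a * t) ≤ a * ψ t := by
  have ha0 : 0 < a := by linarith
  have := ψ.mul_le_map_mul (a := a⁻¹) (t := a * t) (by positivity) (inv_le_one_of_one_le₀ ha)
    (by positivity) hat
  rw [inv_mul_cancel_left₀ ha0.ne'] at this
  rwa [inv_mul_le_iff₀ ha0] at this

theorem pos {a : ℝ} (ha : 0 < a) (ha' : a ≤ 1) : 0 < ψ a := by
  have := ψ.mul_le_map_mul ha.le ha' zero_le_one le_rfl
  rw [mul_one] at this
  exact lt_of_lt_of_le (mul_pos ha ψ.map_one_pos) this

/-- The points `b` and `c` lie symmetrically in `[a, d]`. There `ψ` is above its chord, whose values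
at `b` and `c` add up to `ψ a + ψ d`. -/
theorem add_le_add_of_le {a b c d : ℝ} (ha : 0 ≤ a) (hab : a ≤ b) (hac : a ≤ c) (hd : d ≤ 1)
    (h : d + a = b + c) : ψ d + ψ a ≤ ψ b + ψ c := by
  rcases (show a ≤ d by linarith).eq_or_lt with had | had
  · obtain rfl : b = a := by linarith
    obtain rfl : c = b := by linarith
    rw [had]
  · have hda : 0 < d - a := by linarith
    have key : ∀ x, a ≤ x → x ≤ d → (d - x) / (d - a) * ψ a + (x - a) / (d - a) * ψ d ≤ ψ x := by
      intro x hx hx'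
      have := ψ.concaveOn.2 ⟨ha, had.le.trans hd⟩ ⟨ha.trans had.le, hd⟩
        (div_nonneg (sub_nonneg.2 hx') hda.le) (div_nonneg (sub_nonneg.2 hx) hda.le)
        (by field_simp; ring)
      simp only [smul_eq_mul] at this
      have e : (d - x) / (d - a) * a + (x - a) / (d - a) * d = x := by
        field_simp
        ring
      rwa [e] at this
    have h1 := key b hab (by linarith)
    have h2 := key c hac (by linarith)
    obtain rfl : c = d + a - b := by linarith
    have h3 : (d - b) / (d - a) * ψ a + (b - a) / (d - a) * ψ d +
      ((d - (d + a - b)) / (d - a) * ψ a + (d + a - b - a) / (d - a) * ψ d) = ψ d + ψ a := by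
      field_simp
      ring
    linarith

theorem continuous_projIcc_comp :
    Continuous (fun t : ℝ => ψ (projIcc (0 : ℝ) 1 zero_le_one t)) :=
  ψ.continuousOn.comp_continuous (continuous_subtype_val.comp continuous_projIcc)
    (fun t => (projIcc (0 : ℝ) 1 zero_le_one t).2)

theorem stieltjes_apply {t : ℝ} (ht : 0 ≤ t) (ht' : t ≤ 1) : ψ.stieltjes t = ψ t := by
  change ψ (projIcc (0 : ℝ) 1 zero_le_one t) = _
  rw [projIcc_of_mem zero_le_one ⟨ht, ht'⟩]

theorem stieltjes_measure_Ioo {t : ℝ} (ht : 0 ≤ t) (ht' : t ≤ 1) :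
    ψ.stieltjes.measure (Ioo 0 t) = ENNReal.ofReal (ψ t) := by
  have hc : ContinuousAt ψ.stieltjes t := ψ.continuous_projIcc_comp.continuousAt
  rw [StieltjesFunction.measure_Ioo, ψ.stieltjes_apply le_rfl zero_le_one, ψ.map_zero,
    hc.continuousWithinAt.leftLim_eq, ψ.stieltjes_apply ht ht', sub_zero]

/-! ### Subadditivity of the Choquet integral. -/

variable {X : Type*} [MeasurableSpace X] (P : Measure X) [IsProbabilityMeasure P]

theorem submodular (A : Set X) {B : Set X} (hB : MeasurableSet B) :
    ψ (P.real (A ∪ B)) + ψ (P.real (A ∩ B)) ≤ ψ (P.real A) + ψ (P.real B) :=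
  ψ.add_le_add_of_le measureReal_nonneg (measureReal_mono inter_subset_left)
    (measureReal_mono inter_subset_right) measureReal_le_one (measureReal_union_add_inter hB)

open Classical in
/-- Subadditivity of the Choquet integral of `ψ ∘ P`, for sums of indicators. -/
theorem sum_measure_card_le {ι : Type*} (s : Finset ι) (B : ι → Set X)
    (hB : ∀ i ∈ s, MeasurableSet (B i)) (J : ℕ) :
    ∑ j ∈ Finset.range J, ψ (P.real {ω | j + 1 ≤ (s.filter (fun i => ω ∈ B i)).card}) ≤
      ∑ i ∈ s, ψ (P.real (B i)) := by
  induction s using Finset.induction_on with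
  | empty => simp [ψ.map_zero]
  | insert a s ha ih =>
    set A : ℕ → Set X := fun j => {ω | j ≤ (s.filter (fun i => ω ∈ B i)).card} with hA
    -- One more set raises the count by at most one, exactly on `B a`.
    have hset : ∀ j, {ω | j + 1 ≤ ((insert a s).filter (fun i => ω ∈ B i)).card} =
        A (j + 1) ∪ (A j ∩ B a) := by
      intro j
      ext ω
      simp only [hA, mem_ofPred_eq, mem_union, mem_inter_iff, Finset.filter_insert]
      split_ifs with h
      · rw [Finset.card_insert_of_notMem (by simp [ha])]
        simp only [h, and_true]
        omega
      · simp [h]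
    have hAm : ∀ j, MeasurableSet (A j) := by
      intro j
      have hm : Measurable fun ω => (s.filter (fun i => ω ∈ B i)).card := by
        simp only [Finset.card_filter]
        refine Finset.measurable_sum _ fun i hi => ?_
        exact Measurable.ite (hB i (Finset.mem_insert_of_mem hi)) measurable_const measurable_const
      exact measurableSet_le measurable_const hm
    have hanti : ∀ j, A (j + 1) ⊆ A j := fun j ω (h : _ ≤ _) => (Nat.le_succ j).trans h
    have hBa := hB a (Finset.mem_insert_self a s)
    -- Submodularity for `A (J + 1)` and `A J ∩ B a` leaves the intersection `A (J + 1) ∩ B a`,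
    -- which is carried to the next level. The sum starts from `A 0`, the whole space, whence the
    -- term for `B a`.
    have tele : ∀ J, ∑ j ∈ Finset.range J, ψ (P.real (A (j + 1) ∪ (A j ∩ B a))) +
        ψ (P.real (A J ∩ B a)) ≤
        ∑ j ∈ Finset.range J, ψ (P.real (A (j + 1))) + ψ (P.real (B a)) := by
      intro J
      induction J with
      | zero => simp [hA]
      | succ J ihJ =>
        rw [Finset.sum_range_succ, Finset.sum_range_succ]
        have h := ψ.submodular P (A (J + 1)) ((hAm J).inter hBa)
        have hi : A (J + 1) ∩ (A J ∩ B a) = A (J + 1) ∩ B a := by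
          rw [← inter_assoc, inter_eq_left.2 (hanti J)]
        rw [hi] at h
        linarith
    simp only [hset]
    rw [Finset.sum_insert ha]
    have := tele J
    have h0 : 0 ≤ ψ (P.real (A J ∩ B a)) := ψ.nonneg measureReal_nonneg measureReal_le_one
    have := ih (fun i hi => hB i (Finset.mem_insert_of_mem hi))
    linarith

end PsiClass

/-! ### The layer cake formula and the Fatou property. -/

section Lorentz

variable {X : Type*} [MeasurableSpace X] {P : Measure X}

/-- As `u` decreases to `s`, the sets `{u < |x|}` increase to `{s < |x|}`. By continuity from below
some `u > s` still violates the defining inequality, so the infimum stays strictly above `s`. -/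
theorem lt_decreasingRearrangement_iff {x : X → ℝ} {t : ℝ} {s : ℝ≥0∞} (hs : s ≠ ∞) :
    s < decreasingRearrangement P x t ↔ ENNReal.ofReal t < P {ω | s < ‖x ω‖ₑ} := by
  constructor
  · intro h
    by_contra! h'
    exact absurd (sInf_le h' : decreasingRearrangement P x t ≤ s) (not_le.2 h)
  · intro h
    obtain ⟨u, hu, hu', hlim⟩ := exists_seq_strictAnti_tendsto' hs.lt_top
    have hmono : Monotone fun n => {ω | u n < ‖x ω‖ₑ} :=
      fun m n hmn ω (hω : _ < _) => (hu.antitone hmn).trans_lt hω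
    have hun : ⋃ n, {ω | u n < ‖x ω‖ₑ} = {ω | s < ‖x ω‖ₑ} := by
      ext ω
      simp only [mem_iUnion, mem_ofPred_eq]
      exact ⟨fun ⟨n, hn⟩ => (hu' n).1.trans hn, fun hω => (hlim.eventually_lt_const hω).exists⟩
    have := tendsto_measure_iUnion_atTop (μ := P) hmono
    rw [hun] at this
    obtain ⟨n, hn⟩ := (this.eventually_const_lt h).exists
    refine (hu' n).1.trans_le (le_sInf fun r hr => ?_)
    by_contra! hr'
    refine absurd (hr : _ ≤ _) (not_le.2 (lt_of_lt_of_le hn (measure_mono fun ω hω => ?_)))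
    exact hr'.trans hω

theorem antitone_decreasingRearrangement (x : X → ℝ) :
    Antitone (decreasingRearrangement P x) := fun _ _ h =>
  sInf_le_sInf fun _ (hr : _ ≤ _) => hr.trans (ENNReal.ofReal_le_ofReal h)

theorem lintegral_indicator_ofReal_lt (c : ℝ≥0∞) :
    ∫⁻ s in Ici (0 : ℝ), {s : ℝ | ENNReal.ofReal s < c}.indicator 1 s = c := by
  have hm : MeasurableSet {s : ℝ | ENNReal.ofReal s < c} :=
    measurableSet_lt (by fun_prop) measurable_const
  rw [lintegral_indicator_one hm, Measure.restrict_apply hm]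
  rcases eq_or_ne c ∞ with rfl | hc
  · simp
  · have : {s : ℝ | ENNReal.ofReal s < c} ∩ Ici 0 = Ico 0 c.toReal := by
      ext s
      simp only [mem_inter_iff, mem_ofPred_eq, mem_Ici, mem_Ico, and_comm (b := 0 ≤ s)]
      exact and_congr_right fun h => ENNReal.ofReal_lt_iff_lt_toReal h hc
    rw [this, Real.volume_Ico, sub_zero, ENNReal.ofReal_toReal hc]

theorem lorentzNorm_congr (ψ : PsiClass) {x y : X → ℝ} (h : x =ᵐ[P] y) :
    lorentzNorm ψ P x = lorentzNorm ψ P y := by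
  have : ∀ s : ℝ≥0∞, P {ω | s < ‖x ω‖ₑ} = P {ω | s < ‖y ω‖ₑ} := fun s =>
    measure_congr (by
      filter_upwards [h] with ω hω
      change (s < ‖x ω‖ₑ) = (s < ‖y ω‖ₑ)
      rw [hω])
  simp [lorentzNorm, decreasingRearrangement, this]

variable [IsProbabilityMeasure P] (ψ : PsiClass)

/-- The layer cake formula for the Lorentz norm. -/
theorem lorentzNorm_eq (x : X → ℝ) :
    lorentzNorm ψ P x = ∫⁻ s in Ici (0 : ℝ), ENNReal.ofReal (ψ (P.real {ω | s < |x ω|})) := by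
  have hmeas : Measurable (decreasingRearrangement P x) :=
    (antitone_decreasingRearrangement x).measurable
  unfold lorentzNorm
  -- Tonelli for the indicator of `s < x^*(t)`: the section at fixed `s` is the interval from `0` to
  -- `P(|x| > s)`, of Stieltjes measure `ψ (P(|x| > s))`.
  rw [lintegral_congr fun t => (lintegral_indicator_ofReal_lt (decreasingRearrangement P x t)).symm,
    lintegral_lintegral_swap]
  · refine setLIntegral_congr_fun measurableSet_Ici fun s hs => ?_
    have hs' : (0 : ℝ) ≤ s := hs
    have hset : ∀ t, {s : ℝ | ENNReal.ofReal s < decreasingRearrangement P x t}.indicator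
        (1 : ℝ → ℝ≥0∞) s =
        {t | ENNReal.ofReal s < decreasingRearrangement P x t}.indicator (1 : ℝ → ℝ≥0∞) t := by
      intro t
      simp [indicator_apply]
    simp_rw [hset]
    have hm : MeasurableSet {t | ENNReal.ofReal s < decreasingRearrangement P x t} :=
      measurableSet_lt measurable_const hmeas
    rw [lintegral_indicator_one hm, Measure.restrict_apply hm]
    have h1 : {ω | ENNReal.ofReal s < ‖x ω‖ₑ} = {ω | s < |x ω|} := by
      ext ω
      simp only [mem_ofPred_eq, Real.enorm_eq_ofReal_abs]
      exact ENNReal.ofReal_lt_ofReal_iff_of_nonneg hs'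
    have h2 : {t | ENNReal.ofReal s < decreasingRearrangement P x t} ∩ Ioc 0 1 =
        Ioo 0 (P.real {ω | s < |x ω|}) := by
      ext t
      simp only [lt_decreasingRearrangement_iff ENNReal.ofReal_ne_top, h1, mem_inter_iff,
        mem_ofPred_eq, mem_Ioc, mem_Ioo]
      constructor
      · rintro ⟨h, h0, _⟩
        exact ⟨h0, (ENNReal.ofReal_lt_iff_lt_toReal h0.le (measure_ne_top _ _)).1 h⟩
      · rintro ⟨h0, h⟩
        exact ⟨(ENNReal.ofReal_lt_iff_lt_toReal h0.le (measure_ne_top _ _)).2 h, h0,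
          h.le.trans measureReal_le_one⟩
    rw [h2, ψ.stieltjes_measure_Ioo measureReal_nonneg measureReal_le_one]
  · have : (Function.uncurry fun (t s : ℝ) =>
        {s : ℝ | ENNReal.ofReal s < decreasingRearrangement P x t}.indicator (1 : ℝ → ℝ≥0∞) s) =
        {p : ℝ × ℝ | ENNReal.ofReal p.2 < decreasingRearrangement P x p.1}.indicator 1 := by
      ext p
      simp [Function.uncurry, indicator_apply]
    rw [this]
    exact (measurable_one.indicator
      (measurableSet_lt (by fun_prop) (hmeas.comp measurable_fst))).aemeasurable

theorem antitone_ofReal_map_measure (x : X → ℝ) :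
    Antitone fun s : ℝ => ENNReal.ofReal (ψ (P.real {ω | s < |x ω|})) := fun _ _ h =>
  ENNReal.ofReal_le_ofReal (ψ.mono measureReal_nonneg
    (measureReal_mono fun _ (hω : _ < _) => h.trans_lt hω) measureReal_le_one)

/-- Fatou's lemma in the level `s`. Each `ω` with `s < |x ω|` eventually lies in all the sets `{s <
|y m|}`, and continuity of `ψ` passes to the limit along the increasing sets `F M`. -/
theorem lorentzNorm_le_of_tendsto {x : X → ℝ} {y : ℕ → X → ℝ} {K : ℝ≥0∞}
    (h : ∀ ω, Tendsto (fun m => y m ω) atTop (𝓝 (x ω)))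
    (hK : ∀ m, lorentzNorm ψ P (y m) ≤ K) : lorentzNorm ψ P x ≤ K := by
  simp only [lorentzNorm_eq] at hK ⊢
  have key : ∀ s : ℝ, ENNReal.ofReal (ψ (P.real {ω | s < |x ω|})) ≤
      liminf (fun m => ENNReal.ofReal (ψ (P.real {ω | s < |y m ω|}))) atTop := by
    intro s
    set F : ℕ → Set X := fun M => {ω | ∀ m, M ≤ m → s < |y m ω|}
    have hF : Monotone F := fun M N hMN ω hω m hm => hω m (hMN.trans hm)
    have hsub : {ω | s < |x ω|} ⊆ ⋃ M, F M := by
      intro ω hω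
      have := ((h ω).abs.eventually_const_lt hω)
      obtain ⟨M, hM⟩ := eventually_atTop.1 this
      exact mem_iUnion.2 ⟨M, hM⟩
    have h1 : Tendsto (fun M => P.real (F M)) atTop (𝓝 (P.real (⋃ M, F M))) :=
      (ENNReal.tendsto_toReal (measure_ne_top _ _)).comp (tendsto_measure_iUnion_atTop hF)
    have h2 : Tendsto (fun M => ψ (P.real (F M))) atTop (𝓝 (ψ (P.real (⋃ M, F M)))) :=
      (ψ.continuousOn _ ⟨measureReal_nonneg, measureReal_le_one⟩).tendsto.comp
        (tendsto_nhdsWithin_iff.2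
          ⟨h1, Eventually.of_forall fun M => ⟨measureReal_nonneg, measureReal_le_one⟩⟩)
    calc _ ≤ ENNReal.ofReal (ψ (P.real (⋃ M, F M))) := ENNReal.ofReal_le_ofReal
          (ψ.mono measureReal_nonneg (measureReal_mono hsub) measureReal_le_one)
      _ ≤ _ := by
        refine le_of_tendsto (ENNReal.tendsto_ofReal h2) (Eventually.of_forall fun M => ?_)
        refine le_liminf_of_le (by isBoundedDefault) ?_
        filter_upwards [eventually_ge_atTop M] with m hm
        exact ENNReal.ofReal_le_ofReal (ψ.mono measureReal_nonneg
          (measureReal_mono fun ω hω => hω m hm) measureReal_le_one)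
  calc _ ≤ ∫⁻ s in Ici (0 : ℝ),
        liminf (fun m => ENNReal.ofReal (ψ (P.real {ω | s < |y m ω|}))) atTop :=
        lintegral_mono fun s => key s
    _ ≤ liminf (fun m => ∫⁻ s in Ici (0 : ℝ),
        ENNReal.ofReal (ψ (P.real {ω | s < |y m ω|}))) atTop :=
        lintegral_liminf_le fun m => (antitone_ofReal_map_measure ψ (y m)).measurable
    _ ≤ K := liminf_le_of_frequently_le' (Eventually.of_forall hK).frequently

end Lorentz

/-! ### Riemann sums of mesh `δ`. -/

theorem lintegral_Ico_mul_succ (g : ℝ → ℝ≥0∞) {δ : ℝ} (hδ : 0 ≤ δ) (K : ℕ) :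
    ∫⁻ s in Ico 0 (δ * K), g s =
      ∑ i ∈ Finset.range K, ∫⁻ s in Ico (δ * i) (δ * (i + 1)), g s := by
  induction K with
  | zero => simp
  | succ K ih =>
    rw [Finset.sum_range_succ, ← ih, ← lintegral_union measurableSet_Ico]
    · rw [Ico_union_Ico_eq_Ico (by positivity) (by gcongr; simp)]
      push_cast
      rfl
    · rw [Ico_disjoint_Ico]
      simp

theorem lintegral_Ico_mul_le {g : ℝ → ℝ≥0∞} {δ : ℝ} (hδ : 0 ≤ δ) (K : ℕ) (b : ℕ → ℝ≥0∞)
    (h : ∀ i < K, ∀ s ∈ Ico (δ * i) (δ * (i + 1)), g s ≤ b i) :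
    ∫⁻ s in Ico 0 (δ * K), g s ≤ ∑ i ∈ Finset.range K, b i * ENNReal.ofReal δ := by
  rw [lintegral_Ico_mul_succ g hδ]
  refine Finset.sum_le_sum fun i hi => ?_
  refine (setLIntegral_mono measurable_const (h i (Finset.mem_range.1 hi))).trans ?_
  rw [setLIntegral_const, Real.volume_Ico]
  ring_nf
  rfl

theorem le_lintegral_Ico_mul {g : ℝ → ℝ≥0∞} {δ : ℝ} (hδ : 0 ≤ δ) (K : ℕ) (b : ℕ → ℝ≥0∞)
    (h : ∀ i < K, ∀ s ∈ Ico (δ * i) (δ * (i + 1)), b i ≤ g s) :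
    ∑ i ∈ Finset.range K, b i * ENNReal.ofReal δ ≤ ∫⁻ s in Ico 0 (δ * K), g s := by
  rw [lintegral_Ico_mul_succ g hδ]
  refine Finset.sum_le_sum fun i hi => ?_
  refine le_trans ?_ (setLIntegral_mono' measurableSet_Ico (h i (Finset.mem_range.1 hi)))
  rw [setLIntegral_const, Real.volume_Ico]
  ring_nf
  rfl

/-! ### Tails of sums of independent symmetric `{-1, 0, 1}`-valued variables. -/

/-- The weight of a sign for a symmetric variable that is nonzero with probability `u`. -/
noncomputable def signWeight (u : ℝ) (a : SignType) : ℝ := if a = 0 then 1 - u else u / 2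

/-- The probability that the modulus of the sum of `n` independent symmetric `{-1, 0, 1}`-valued
variables, each nonzero with probability `u`, is at least `j`. -/
noncomputable def tailProb (n j : ℕ) (u : ℝ) : ℝ :=
  ∑ τ : Fin n → SignType with j ≤ (∑ i, (τ i : ℤ)).natAbs, ∏ i, signWeight u (τ i)

theorem SignType.sum_univ {M : Type*} [AddCommMonoid M] (f : SignType → M) :
    ∑ a, f a = f 0 + (f (-1) + f 1) := by
  rw [SignType.univ_eq, Finset.sum_insert (by decide), Finset.sum_pair (by decide)]

theorem SignType.natAbs_coe_le_one (a : SignType) : (a : ℤ).natAbs ≤ 1 := by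
  cases a <;> decide

theorem SignType.natAbs_sum_le {n : ℕ} (τ : Fin n → SignType) :
    (∑ i, (τ i : ℤ)).natAbs ≤ ∑ i, (τ i : ℤ).natAbs := Int.natAbs_sum_le _ _

section tailProb

variable {u : ℝ}

theorem signWeight_nonneg (h0 : 0 ≤ u) (h1 : u ≤ 1) (a : SignType) : 0 ≤ signWeight u a := by
  unfold signWeight
  split_ifs <;> linarith

theorem sum_signWeight (u : ℝ) : ∑ a, signWeight u a = 1 := by
  rw [SignType.sum_univ]
  simp [signWeight]

theorem sum_prod_signWeight (n : ℕ) (u : ℝ) :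
    ∑ τ : Fin n → SignType, ∏ i, signWeight u (τ i) = 1 := by
  rw [← Fintype.piFinset_univ, ← Finset.prod_univ_sum]
  simp [sum_signWeight]

theorem sum_prod_signWeight_mul_natAbs (n : ℕ) (u : ℝ) (k : Fin n) :
    ∑ τ : Fin n → SignType, (∏ i, signWeight u (τ i)) * (τ k : ℤ).natAbs = u := by
  have h : ∀ τ : Fin n → SignType, (∏ i, signWeight u (τ i)) * ((τ k : ℤ).natAbs : ℝ) =
      ∏ i, signWeight u (τ i) * (if i = k then ((τ i : ℤ).natAbs : ℝ) else 1) := by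
    intro τ
    rw [Finset.prod_mul_distrib, Finset.prod_ite_eq' Finset.univ k]
    simp
  simp_rw [h]
  rw [← Fintype.piFinset_univ, ← Finset.prod_univ_sum (fun _ => Finset.univ)
    (fun i a => signWeight u a * (if i = k then ((a : ℤ).natAbs : ℝ) else 1)),
    Finset.prod_eq_single k]
  · rw [SignType.sum_univ]
    simp [signWeight]
  · intro b _ hb
    simp [hb, sum_signWeight]
  · simp

theorem prod_signWeight_nonneg {n : ℕ} (h0 : 0 ≤ u) (h1 : u ≤ 1) (τ : Fin n → SignType) :
    0 ≤ ∏ i, signWeight u (τ i) := Finset.prod_nonneg fun _ _ => signWeight_nonneg h0 h1 _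

theorem tailProb_nonneg (h0 : 0 ≤ u) (h1 : u ≤ 1) (n j : ℕ) : 0 ≤ tailProb n j u :=
  Finset.sum_nonneg fun _ _ => prod_signWeight_nonneg h0 h1 _

theorem tailProb_le_one (h0 : 0 ≤ u) (h1 : u ≤ 1) (n j : ℕ) : tailProb n j u ≤ 1 := by
  rw [← sum_prod_signWeight n u]
  exact Finset.sum_le_sum_of_subset_of_nonneg (Finset.filter_subset _ _)
    fun _ _ _ => prod_signWeight_nonneg h0 h1 _

theorem continuous_tailProb (n j : ℕ) : Continuous (tailProb n j) := by
  refine continuous_finsetSum _ fun τ _ => continuous_finsetProd _ fun i _ => ?_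
  unfold signWeight
  split_ifs <;> fun_prop

/-- The tails add up to the mean of `|∑ τ i|`, and `n u` is the mean of `∑ |τ i|`. The triangle
inequality is strict at `(-1, 1, …, 1)`, which has positive probability. -/
theorem sum_tailProb_lt {n : ℕ} (hn : 2 ≤ n) (h0 : 0 < u) (h1 : u ≤ 1) :
    ∑ j ∈ Finset.range n, tailProb n (j + 1) u < n * u := by
  have h : ∑ j ∈ Finset.range n, tailProb n (j + 1) u =
      ∑ τ : Fin n → SignType, (∏ i, signWeight u (τ i)) * ((∑ i, (τ i : ℤ)).natAbs : ℝ) := by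
    simp only [tailProb, Finset.sum_filter]
    rw [Finset.sum_comm]
    refine Finset.sum_congr rfl fun τ _ => ?_
    rw [← Finset.sum_filter, Finset.sum_const, nsmul_eq_mul, mul_comm]
    congr 2
    have hle : (∑ i, (τ i : ℤ)).natAbs ≤ n := by
      refine (SignType.natAbs_sum_le τ).trans
        ((Finset.sum_le_sum fun i _ => SignType.natAbs_coe_le_one (τ i)).trans ?_)
      simp
    have : Finset.filter (fun j => j + 1 ≤ (∑ i, (τ i : ℤ)).natAbs) (Finset.range n) =
        Finset.range (∑ i, (τ i : ℤ)).natAbs := by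
      ext j
      simp only [Finset.mem_filter, Finset.mem_range]
      omega
    rw [this, Finset.card_range]
  have h' : (n : ℝ) * u = ∑ τ : Fin n → SignType,
      (∏ i, signWeight u (τ i)) * ((∑ i, (τ i : ℤ).natAbs : ℕ) : ℝ) := by
    simp only [Nat.cast_sum, Finset.mul_sum]
    rw [Finset.sum_comm]
    simp only [sum_prod_signWeight_mul_natAbs]
    simp
  rw [h, h']
  refine Finset.sum_lt_sum (fun τ _ => mul_le_mul_of_nonneg_left
    (by exact_mod_cast SignType.natAbs_sum_le τ) (prod_signWeight_nonneg h0.le h1 τ)) ?_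
  obtain ⟨m, rfl⟩ : ∃ m, n = m + 2 := ⟨n - 2, by omega⟩
  refine ⟨Fin.cons (-1) fun _ => 1, Finset.mem_univ _, ?_⟩
  refine mul_lt_mul_of_pos_left ?_ (Finset.prod_pos fun i _ => ?_)
  · norm_cast
    simp only [Fin.sum_univ_succ, Fin.cons_zero, Fin.cons_succ]
    simp
    omega
  · refine Fin.cases ?_ (fun i => ?_) i <;> simp [signWeight, h0]

theorem pow_le_tailProb {n j : ℕ} (hj : j ≤ n) (h0 : 0 ≤ u) (h1 : u ≤ 1) :
    (u / 2) ^ n ≤ tailProb n j u := by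
  have := Finset.single_le_sum (f := fun τ : Fin n → SignType => ∏ i, signWeight u (τ i))
    (s := Finset.univ.filter fun τ => j ≤ (∑ i, (τ i : ℤ)).natAbs)
    (fun τ _ => prod_signWeight_nonneg h0 h1 τ) (a := fun _ => 1) (by simp [hj])
  refine le_trans (le_of_eq ?_) this
  simp [signWeight, div_pow]

/-- A sum of modulus at least `j` needs at least `j` nonzero signs, each costing a factor `u`; there
are `3 ^ n` patterns. -/
theorem tailProb_le_mul_pow (n j : ℕ) (h0 : 0 ≤ u) (h1 : u ≤ 1) :
    tailProb n j u ≤ 3 ^ n * u ^ j := by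
  have hτ : ∀ τ ∈ Finset.univ.filter fun τ : Fin n → SignType => j ≤ (∑ i, (τ i : ℤ)).natAbs,
      ∏ i, signWeight u (τ i) ≤ u ^ j := by
    intro τ hτ
    have hj := ((Finset.mem_filter.1 hτ).2).trans (SignType.natAbs_sum_le τ)
    calc ∏ i, signWeight u (τ i) ≤ ∏ i, u ^ (τ i : ℤ).natAbs := by
          refine Finset.prod_le_prod (fun i _ => signWeight_nonneg h0 h1 _) fun i _ => ?_
          rcases τ i with _ | _ | _ <;> simp [signWeight, h0]
      _ = u ^ ∑ i, (τ i : ℤ).natAbs := Finset.prod_pow_eq_pow_sum _ _ _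
      _ ≤ u ^ j := pow_le_pow_of_le_one h0 h1 hj
  refine (Finset.sum_le_card_nsmul _ _ _ hτ).trans ?_
  rw [nsmul_eq_mul]
  refine mul_le_mul_of_nonneg_right ?_ (by positivity)
  have : (Finset.univ.filter fun τ : Fin n → SignType =>
      j ≤ (∑ i, (τ i : ℤ)).natAbs).card ≤ 3 ^ n := by
    refine (Finset.card_filter_le _ _).trans ?_
    have h3 : Fintype.card SignType = 3 := rfl
    simp [h3]
  exact_mod_cast this

theorem SignType.eq_const_of_sum_eq {n : ℕ} {τ : Fin n → SignType} (h : ∑ i, (τ i : ℤ) = n) :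
    τ = fun _ => 1 := by
  have h1 : ∀ a : SignType, (0 : ℤ) ≤ 1 - a := by decide
  have h2 : ∀ a : SignType, (1 : ℤ) - a = 0 → a = 1 := by decide
  have h3 : ∑ i, ((1 : ℤ) - τ i) = 0 := by simp [h]
  rw [Finset.sum_eq_zero_iff_of_nonneg fun i _ => h1 _] at h3
  exact funext fun i => h2 _ (h3 i (Finset.mem_univ _))

theorem tailProb_self_le (n : ℕ) (h0 : 0 ≤ u) (h1 : u ≤ 1) :
    tailProb n n u ≤ 2 * (u / 2) ^ n := by
  have hsub : (Finset.univ.filter fun τ : Fin n → SignType => n ≤ (∑ i, (τ i : ℤ)).natAbs) ⊆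
      {fun _ => 1, fun _ => -1} := by
    intro τ hτ
    have hn := (Finset.mem_filter.1 hτ).2
    have hle : (∑ i, (τ i : ℤ)).natAbs ≤ n := by
      refine (SignType.natAbs_sum_le τ).trans
        ((Finset.sum_le_sum fun i _ => SignType.natAbs_coe_le_one (τ i)).trans ?_)
      simp
    rcases Int.natAbs_eq_iff.1 (le_antisymm hle hn) with h | h
    · simp [SignType.eq_const_of_sum_eq h]
    · have : (fun i => -τ i) = fun _ => 1 := by
        refine SignType.eq_const_of_sum_eq ?_
        have : ∀ a : SignType, ((-a : SignType) : ℤ) = -a := by decide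
        simp [this, h]
      have : τ = fun _ => -1 := funext fun i => by
        rw [← congrFun this i, neg_neg]
      simp [this]
  refine (Finset.sum_le_sum_of_subset_of_nonneg hsub
    fun τ _ _ => prod_signWeight_nonneg h0 h1 τ).trans ?_
  refine (Finset.sum_le_card_nsmul _ _ ((u / 2) ^ n) fun τ hτ => ?_).trans ?_
  · simp only [Finset.mem_insert, Finset.mem_singleton] at hτ
    rcases hτ with rfl | rfl <;> simp [signWeight, div_pow]
  · rw [nsmul_eq_mul]
    refine mul_le_mul_of_nonneg_right ?_ (by positivity)
    exact_mod_cast Finset.card_le_two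

/-- Only the patterns with exactly one nonzero sign are kept: `2 n` of them, each of weight `u / 2 *
(1 - u) ^ (n - 1)`. -/
theorem mul_one_sub_pow_le_tailProb (n : ℕ) (h0 : 0 ≤ u) (h1 : u ≤ 1) :
    n * u * (1 - u) ^ (n - 1) ≤ tailProb n 1 u := by
  classical
  set e : Fin n × Bool → (Fin n → SignType) := fun p => Pi.single p.1 (if p.2 then 1 else -1)
  have he1 : ∀ p, e p p.1 ≠ 0 := fun p => by simp only [e, Pi.single_eq_same]; split_ifs <;> decide
  have hinj : Function.Injective e := by
    intro p q h
    have h12 : p.1 = q.1 := by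
      by_contra hne
      refine he1 p ?_
      rw [h]
      simp [e, hne]
    have h22 := congrFun h p.1
    simp only [e, h12, Pi.single_eq_same] at h22
    refine Prod.ext h12 ?_
    revert h22
    cases p.2 <;> cases q.2 <;> simp
  have hsub : Finset.univ.image e ⊆
      Finset.univ.filter fun τ : Fin n → SignType => 1 ≤ (∑ i, (τ i : ℤ)).natAbs := by
    intro τ hτ
    obtain ⟨p, -, rfl⟩ := Finset.mem_image.1 hτ
    refine Finset.mem_filter.2 ⟨Finset.mem_univ _, ?_⟩
    rw [Finset.sum_eq_single p.1]
    · simp only [e, Pi.single_eq_same]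
      split_ifs <;> decide
    · intro b _ hb
      simp [e, hb]
    · simp
  refine le_trans (le_of_eq ?_) (Finset.sum_le_sum_of_subset_of_nonneg hsub
    fun τ _ _ => prod_signWeight_nonneg h0 h1 τ)
  rw [Finset.sum_image hinj.injOn]
  have hprod : ∀ p : Fin n × Bool, ∏ i, signWeight u (e p i) = u / 2 * (1 - u) ^ (n - 1) := by
    intro p
    rw [← Finset.mul_prod_erase _ _ (Finset.mem_univ p.1)]
    congr 1
    · simp [signWeight, he1]
    · rw [Finset.prod_congr rfl (g := fun _ => 1 - u)]
      · simp
      · intro i hi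
        simp [signWeight, e, Finset.ne_of_mem_erase hi]
  simp only [hprod, Finset.sum_const, nsmul_eq_mul]
  simp
  ring

end tailProb

/-! ### The distribution of `A_n` on sign-valued functions. -/

theorem measureReal_unitInterval_le_half :
    (volume : Measure I).real {t | (t : ℝ) ≤ 1 / 2} = 1 / 2 := by
  have : {t : I | (t : ℝ) ≤ 1 / 2} = Iic ⟨1 / 2, by norm_num, by norm_num⟩ := rfl
  rw [measureReal_def, this, unitInterval.volume_Iic]
  simp

theorem measurableSet_le_half : MeasurableSet {t : I | (t : ℝ) ≤ 1 / 2} :=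
  measurableSet_le measurable_subtype_coe measurable_const

theorem setOf_sign_mul_bernoulli_eq (h : I → SignType) (a : SignType) :
    {p : I × I | h p.1 * (if (p.2 : ℝ) ≤ 1 / 2 then 1 else -1) = a} =
      (h ⁻¹' {a}) ×ˢ {t : I | (t : ℝ) ≤ 1 / 2} ∪ (h ⁻¹' {-a}) ×ˢ {t : I | (t : ℝ) ≤ 1 / 2}ᶜ := by
  ext p
  simp only [mem_ofPred_eq, mem_union, mem_prod, mem_preimage, mem_singleton_iff, mem_compl_iff]
  generalize h p.1 = b
  by_cases hp : (p.2 : ℝ) ≤ 1 / 2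
  · simp only [hp, if_true, mul_one, and_true, not_true_eq_false, and_false, or_false]
  · simp only [hp, if_false, and_false, not_false_eq_true, and_true, false_or]
    revert a b
    decide

/-- The product of a sign-valued function and an independent centered Bernoulli variable. -/
theorem measureReal_sign_mul_bernoulli {h : I → SignType} (hh : ∀ a, MeasurableSet (h ⁻¹' {a}))
    (a : SignType) :
    (volume : Measure (I × I)).real {p | h p.1 * (if (p.2 : ℝ) ≤ 1 / 2 then 1 else -1) = a} =
      signWeight ((volume : Measure I).real {s | h s ≠ 0}) a := by
  set T : Set I := {t | (t : ℝ) ≤ 1 / 2} with hT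
  have hTm : MeasurableSet T := measurableSet_le_half
  have hvT : (volume : Measure I).real T = 1 / 2 := measureReal_unitInterval_le_half
  have hvT' : (volume : Measure I).real Tᶜ = 1 / 2 := by
    rw [probReal_compl_eq_one_sub hTm, hvT]
    norm_num
  have hprod : ∀ A B : Set I, (volume : Measure (I × I)).real (A ×ˢ B) =
      (volume : Measure I).real A * (volume : Measure I).real B := fun A B =>
    measureReal_prod_prod A B
  rw [setOf_sign_mul_bernoulli_eq, measureReal_union _ ((hh _).prod hTm.compl), hprod, hprod, hvT, hvT']
  · have hne : {s | h s ≠ 0} = h ⁻¹' {1} ∪ h ⁻¹' {-1} := by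
      ext s
      simp only [mem_ofPred_eq, mem_union, mem_preimage, mem_singleton_iff]
      generalize h s = b
      revert b
      decide
    have hu : (volume : Measure I).real {s | h s ≠ 0} =
        (volume : Measure I).real (h ⁻¹' {1}) + (volume : Measure I).real (h ⁻¹' {-1}) := by
      rw [hne, measureReal_union _ (hh _)]
      rw [Set.disjoint_left]
      intro s hs hs'
      exact absurd (hs.symm.trans hs') (by decide)
    have h0 : (volume : Measure I).real (h ⁻¹' {0}) =
        1 - (volume : Measure I).real {s | h s ≠ 0} := by
      have : {s | h s ≠ 0} = (h ⁻¹' {0})ᶜ := rfl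
      rw [this, probReal_compl_eq_one_sub (hh 0)]
      ring
    rcases a with _ | _ | _
    · change (volume : Measure I).real (h ⁻¹' {0}) * _ +
        (volume : Measure I).real (h ⁻¹' {0}) * _ = 1 - _
      rw [h0]
      ring
    · change (volume : Measure I).real (h ⁻¹' {-1}) * _ +
        (volume : Measure I).real (h ⁻¹' {1}) * _ = _ / 2
      rw [hu]
      ring
    · change (volume : Measure I).real (h ⁻¹' {1}) * _ +
        (volume : Measure I).real (h ⁻¹' {-1}) * _ = _ / 2
      rw [hu]
      ring
  · rw [Set.disjoint_left]
    rintro p ⟨-, hp⟩ ⟨-, hp'⟩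
    exact hp' hp

theorem bernoulliSign_eq (t : I) :
    bernoulliSign t = ((if (t : ℝ) ≤ 1 / 2 then 1 else -1 : SignType) : ℝ) := by
  unfold bernoulliSign
  split_ifs <;> simp

theorem abs_operatorA_sign {n : ℕ} (h : I → SignType) (ω : Fin n → I × I) :
    |operatorA n (fun s => (h s : ℝ)) ω| =
      (∑ i, ((h (ω i).1 * (if ((ω i).2 : ℝ) ≤ 1 / 2 then 1 else -1) : SignType) : ℤ)).natAbs := by
  have hc : ∀ a : SignType, (a : ℝ) = ((a : ℤ) : ℝ) := fun a => by cases a <;> simp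
  rw [Nat.cast_natAbs, Int.cast_abs, Int.cast_sum]
  unfold operatorA
  congr 1
  refine Finset.sum_congr rfl fun i _ => ?_
  rw [bernoulliSign_eq, ← hc, SignType.coe_mul]

/-- The event is a disjoint union of boxes, one for each admissible sign pattern, and the measure of
a box is a product of weights. -/
theorem measureReal_le_abs_operatorA_sign {n : ℕ} {h : I → SignType}
    (hh : ∀ a, MeasurableSet (h ⁻¹' {a})) (j : ℕ) :
    MeasurableSet {ω : Fin n → I × I | (j : ℝ) ≤ |operatorA n (fun s => (h s : ℝ)) ω|} ∧
    (volume : Measure (Fin n → I × I)).real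
      {ω | (j : ℝ) ≤ |operatorA n (fun s => (h s : ℝ)) ω|} =
      tailProb n j ((volume : Measure I).real {s | h s ≠ 0}) := by
  set ρ : I × I → SignType := fun p => h p.1 * (if (p.2 : ℝ) ≤ 1 / 2 then 1 else -1) with hρ
  have hρm : ∀ a, MeasurableSet {p | ρ p = a} := by
    intro a
    rw [hρ, setOf_sign_mul_bernoulli_eq]
    exact ((hh _).prod measurableSet_le_half).union ((hh _).prod measurableSet_le_half.compl)
  have hset : {ω : Fin n → I × I | (j : ℝ) ≤ |operatorA n (fun s => (h s : ℝ)) ω|} =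
      ⋃ τ ∈ Finset.univ.filter fun τ : Fin n → SignType => j ≤ (∑ i, (τ i : ℤ)).natAbs,
        univ.pi fun i => {p | ρ p = τ i} := by
    ext ω
    simp only [mem_ofPred_eq, abs_operatorA_sign, Nat.cast_le, mem_iUnion, Finset.mem_filter,
      Finset.mem_univ, true_and, mem_univ_pi, exists_prop]
    constructor
    · intro hj
      exact ⟨fun i => ρ (ω i), hj, fun i => rfl⟩
    · rintro ⟨τ, hj, hτ⟩
      have : τ = fun i => ρ (ω i) := funext fun i => (hτ i).symm
      subst this
      exact hj
  have hm : ∀ τ : Fin n → SignType, MeasurableSet (univ.pi fun i => {p | ρ p = τ i}) :=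
    fun τ => MeasurableSet.univ_pi fun i => hρm _
  rw [hset]
  refine ⟨Finset.measurableSet_biUnion _ fun τ _ => hm τ, ?_⟩
  rw [measureReal_biUnion_finset _ fun τ _ => hm τ]
  · refine Finset.sum_congr rfl fun τ _ => ?_
    rw [measureReal_def, volume_pi, Measure.pi_pi, ENNReal.toReal_prod]
    exact Finset.prod_congr rfl fun i _ => measureReal_sign_mul_bernoulli hh (τ i)
  · intro τ _ κ _ hne
    rw [Function.onFun, Set.disjoint_left]
    intro ω h1 h2
    refine hne (funext fun i => ?_)
    exact (h1 i (mem_univ _) : ρ (ω i) = τ i).symm.trans (h2 i (mem_univ _))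

/-! ### Reduction of the operator norm to indicators. -/

section reduction

variable (ψ : PsiClass)

-- For `t` in `[δ j, δ (j + 1))`, exceeding `t` forces membership in at least `j + 1` of the sets,
-- so the layer cake integral is at most `δ` times the sum in `sum_measure_card_le`.
open Classical in
theorem lorentzNorm_le_of_abs_le_card {X : Type*} [MeasurableSpace X] {P : Measure X}
    [IsProbabilityMeasure P] {ι : Type*} (s : Finset ι) (B : ι → Set X)
    (hB : ∀ i ∈ s, MeasurableSet (B i)) {δ : ℝ} (hδ : 0 < δ) {x : X → ℝ}
    (hx : ∀ ω, |x ω| ≤ δ * (s.filter (fun i => ω ∈ B i)).card) :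
    lorentzNorm ψ P x ≤ ENNReal.ofReal (δ * ∑ i ∈ s, ψ (P.real (B i))) := by
  have hK : 0 ≤ δ * (s.card : ℝ) := by positivity
  rw [lorentzNorm_eq, ← Ico_union_Ici_eq_Ici hK,
    lintegral_union measurableSet_Ici (disjoint_left.2 fun a h h' => not_le.2 h.2 h')]
  have h2 : ∫⁻ t in Ici (δ * (s.card : ℝ)), ENNReal.ofReal (ψ (P.real {ω | t < |x ω|})) = 0 := by
    rw [setLIntegral_congr_fun (g := fun _ => 0) measurableSet_Ici]
    · simp
    · intro t ht
      have : {ω | t < |x ω|} = ∅ := by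
        refine eq_empty_iff_forall_notMem.2 fun ω (hω : t < |x ω|) => ?_
        have h1 : δ * ((s.filter (fun i => ω ∈ B i)).card : ℝ) ≤ δ * s.card := by
          gcongr
          exact Finset.filter_subset _ _
        have h3 : δ * (s.card : ℝ) ≤ t := ht
        linarith [hx ω]
      simp [this, ψ.map_zero]
  rw [h2, add_zero]
  refine (lintegral_Ico_mul_le hδ.le s.card (fun j => ENNReal.ofReal
    (ψ (P.real {ω | j + 1 ≤ (s.filter (fun i => ω ∈ B i)).card}))) ?_).trans ?_
  · intro j _ t ht
    refine ENNReal.ofReal_le_ofReal (ψ.mono measureReal_nonneg (measureReal_mono ?_)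
      measureReal_le_one)
    intro ω (hω : t < |x ω|)
    have h1 : δ * (j : ℝ) < δ * ((s.filter (fun i => ω ∈ B i)).card : ℝ) :=
      (ht.1.trans_lt hω).trans_le (hx ω)
    have h3 := lt_of_mul_lt_mul_left h1 hδ.le
    exact Nat.succ_le_of_lt (by exact_mod_cast h3)
  · rw [← Finset.sum_mul, mul_comm δ, ENNReal.ofReal_mul
      (Finset.sum_nonneg fun i _ => ψ.nonneg measureReal_nonneg measureReal_le_one)]
    gcongr
    rw [← ENNReal.ofReal_sum_of_nonneg
      fun i _ => ψ.nonneg measureReal_nonneg measureReal_le_one]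
    exact ENNReal.ofReal_le_ofReal (ψ.sum_measure_card_le P s B hB _)

theorem sum_tailProb_le_lorentzNorm_operatorA {n : ℕ} {h : I → SignType}
    (hh : ∀ a, MeasurableSet (h ⁻¹' {a})) :
    ENNReal.ofReal (∑ j ∈ Finset.range n,
      ψ (tailProb n (j + 1) ((volume : Measure I).real {s | h s ≠ 0}))) ≤
    lorentzNorm ψ (volume : Measure (Fin n → I × I)) (operatorA n fun s => (h s : ℝ)) := by
  rw [lorentzNorm_eq, ENNReal.ofReal_sum_of_nonneg fun i _ => ψ.nonneg
    (tailProb_nonneg measureReal_nonneg measureReal_le_one _ _)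
    (tailProb_le_one measureReal_nonneg measureReal_le_one _ _)]
  have := le_lintegral_Ico_mul (g := fun s => ENNReal.ofReal (ψ
    ((volume : Measure (Fin n → I × I)).real {ω | s < |operatorA n (fun s => (h s : ℝ)) ω|})))
    zero_le_one n (fun j => ENNReal.ofReal
      (ψ (tailProb n (j + 1) ((volume : Measure I).real {s | h s ≠ 0})))) ?_
  · simp only [ENNReal.ofReal_one, mul_one] at this
    exact this.trans (lintegral_mono_set Ico_subset_Ici_self)
  · intro j _ s hs
    refine ENNReal.ofReal_le_ofReal ?_
    rw [← (measureReal_le_abs_operatorA_sign hh (j + 1)).2]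
    refine ψ.mono measureReal_nonneg (measureReal_mono ?_) measureReal_le_one
    intro ω hω
    have := hs.2
    simp only [mem_ofPred_eq] at hω
    push_cast at hω
    rw [one_mul] at this
    exact this.trans_le hω

/-- The operator is tested on the indicator of `[0, u]`, whose norm is at most `ψ u`. -/
theorem exists_lt_of_operatorANorm_lt {n : ℕ} (hn : operatorANorm ψ n < n) :
    ∃ c : ℝ, c < n ∧ ∀ u, 0 < u → u ≤ 1 →
      ∑ j ∈ Finset.range n, ψ (tailProb n (j + 1) u) ≤ c * ψ u := by
  obtain ⟨C, hC, hCn⟩ := sInf_lt_iff.1 hn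
  have hCtop : C ≠ ∞ := (hCn.trans (ENNReal.natCast_lt_top n)).ne
  refine ⟨C.toReal, ?_, fun u h0 h1 => ?_⟩
  · rw [← ENNReal.toReal_natCast n]
    exact (ENNReal.toReal_lt_toReal hCtop (ENNReal.natCast_ne_top n)).2 hCn
  set h : I → SignType := fun s => if (s : ℝ) ≤ u then 1 else 0 with hdef
  have hm : MeasurableSet {s : I | (s : ℝ) ≤ u} :=
    measurableSet_le measurable_subtype_coe measurable_const
  have hh : ∀ a, MeasurableSet (h ⁻¹' {a}) := by
    let _ : MeasurableSpace SignType := ⊤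
    have : Measurable h := Measurable.ite hm measurable_const measurable_const
    exact fun a => this (MeasurableSpace.measurableSet_top (s := {a}))
  have hne : {s | h s ≠ 0} = {s : I | (s : ℝ) ≤ u} := by
    ext s
    by_cases hs : (s : ℝ) ≤ u <;> simp [hdef, hs]
  have hvol : (volume : Measure I).real {s : I | (s : ℝ) ≤ u} = u := by
    have : {s : I | (s : ℝ) ≤ u} = Iic ⟨u, h0.le, h1⟩ := rfl
    rw [measureReal_def, this, unitInterval.volume_Iic]
    simp [h0.le]
  have hnorm : lorentzNorm ψ (volume : Measure I) (fun s => (h s : ℝ)) ≤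
      ENNReal.ofReal (ψ u) := by
    refine (lorentzNorm_le_of_abs_le_card ψ (P := (volume : Measure I)) ({()} : Finset Unit)
      (fun _ => {s | (s : ℝ) ≤ u}) (fun _ _ => hm) one_pos fun s => ?_).trans ?_
    · by_cases hs : (s : ℝ) ≤ u <;> simp [hdef, hs, Finset.filter_singleton]
    · simp [hvol]
  have hmeas : Measurable fun s => (h s : ℝ) := by
    have : (fun s => (h s : ℝ)) = fun s : I => if (s : ℝ) ≤ u then 1 else 0 := by
      ext s
      by_cases hs : (s : ℝ) ≤ u <;> simp [hdef, hs]
    rw [this]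
    exact Measurable.ite hm measurable_const measurable_const
  have key := (sum_tailProb_le_lorentzNorm_operatorA ψ (n := n) hh).trans
    ((hC _ ⟨hmeas.aemeasurable, hnorm.trans_lt ENNReal.ofReal_lt_top⟩).trans
      (mul_le_mul_right hnorm C))
  rw [hne, hvol, ← ENNReal.ofReal_toReal hCtop, ← ENNReal.ofReal_mul ENNReal.toReal_nonneg] at key
  exact (ENNReal.ofReal_le_ofReal_iff
    (mul_nonneg ENNReal.toReal_nonneg (ψ.nonneg h0.le h1))).1 key

theorem abs_sum_ite_lt_sub_le {K : ℕ} {a : ℝ} (ha : 0 ≤ a) (haK : a ≤ K) :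
    |∑ i ∈ Finset.range K, (if (i + 1 : ℝ) < a then (1 : ℝ) else 0) - a| ≤ 1 := by
  have h : Finset.filter (fun i : ℕ => (i + 1 : ℝ) < a) (Finset.range K) =
      Finset.range (⌈a⌉₊ - 1) := by
    ext i
    have h1 : ((i + 1 : ℝ) < a) ↔ i + 1 < ⌈a⌉₊ := by
      rw [Nat.lt_ceil]
      push_cast
      rfl
    have h2 : ⌈a⌉₊ ≤ K := Nat.ceil_le.2 haK
    simp only [Finset.mem_filter, Finset.mem_range, h1]
    omega
  rw [← Finset.sum_filter, h, Finset.sum_const, Finset.card_range, nsmul_one, abs_le]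
  have h1 := Nat.le_ceil a
  have h2 := Nat.ceil_lt_add_one ha
  have h3 : ((⌈a⌉₊ : ℕ) : ℝ) ≤ ((⌈a⌉₊ - 1 : ℕ) : ℝ) + 1 := by
    exact_mod_cast (by omega : ⌈a⌉₊ ≤ ⌈a⌉₊ - 1 + 1)
  -- The count is `⌈a⌉₊ - 1` with truncated subtraction, so `a = 0` is separate.
  rcases Nat.eq_zero_or_pos ⌈a⌉₊ with h0 | h0
  · rw [h0] at h1 ⊢
    constructor <;> norm_num <;> simp at h1 <;> linarith
  · have h4 : ((⌈a⌉₊ - 1 : ℕ) : ℝ) + 1 = (⌈a⌉₊ : ℝ) := by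
      exact_mod_cast (by omega : ⌈a⌉₊ - 1 + 1 = ⌈a⌉₊)
    constructor <;> linarith

/-- The sign of `f` on the set where `|f|` exceeds `t`. -/
noncomputable def truncatedSign {X : Type*} (f : X → ℝ) (t : ℝ) (s : X) : SignType :=
  if t < |f s| then SignType.sign (f s) else 0

theorem setOf_truncatedSign_ne_zero {X : Type*} (f : X → ℝ) {t : ℝ} (ht : 0 ≤ t) :
    {s | truncatedSign f t s ≠ 0} = {s | t < |f s|} := by
  ext s
  by_cases hs : t < |f s|
  · have : f s ≠ 0 := abs_pos.1 (ht.trans_lt hs)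
    simp [truncatedSign, hs, this]
  · simp [truncatedSign, hs]

theorem measurableSet_truncatedSign_preimage {X : Type*} [MeasurableSpace X] {f : X → ℝ}
    (hf : Measurable f) (t : ℝ) (a : SignType) :
    MeasurableSet (truncatedSign f t ⁻¹' {a}) := by
  let _ : MeasurableSpace SignType := ⊤
  have hsign : Measurable (SignType.sign : ℝ → SignType) := by
    have : (SignType.sign : ℝ → SignType) = fun x => if 0 < x then 1 else if x < 0 then -1 else 0 :=
      funext fun x => sign_apply
    rw [this]
    exact Measurable.ite measurableSet_Ioi measurable_const
      (Measurable.ite measurableSet_Iio measurable_const measurable_const)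
  have : Measurable (truncatedSign f t) := by
    have hc : MeasurableSet {s | t < |f s|} :=
      measurableSet_lt measurable_const (measurable_abs.comp hf)
    exact Measurable.ite hc (hsign.comp hf) measurable_const
  exact this (MeasurableSpace.measurableSet_top (s := {a}))

/-- With mesh `1 / (m + 1)`, the `(m + 1) ^ 2` levels reach height `m + 1`; once this exceeds `|f
s|`, the error is at most one mesh. -/
theorem tendsto_sum_truncatedSign {X : Type*} (f : X → ℝ) (s : X) :
    Tendsto (fun m : ℕ => ((m : ℝ) + 1)⁻¹ * ∑ i ∈ Finset.range ((m + 1) ^ 2),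
      (truncatedSign f (((m : ℝ) + 1)⁻¹ * (i + 1)) s : ℝ)) atTop (𝓝 (f s)) := by
  rw [tendsto_iff_dist_tendsto_zero]
  refine squeeze_zero' (Eventually.of_forall fun m => dist_nonneg) ?_
    tendsto_one_div_add_atTop_nhds_zero_nat
  filter_upwards [eventually_ge_atTop ⌈|f s|⌉₊] with m hm
  have hd : (0 : ℝ) < (m : ℝ) + 1 := by positivity
  have hfm : |f s| ≤ (m : ℝ) + 1 := by
    have : |f s| ≤ m := (Nat.le_ceil _).trans (by exact_mod_cast hm)
    linarith
  have h1 := abs_sum_ite_lt_sub_le (K := (m + 1) ^ 2) (a := ((m : ℝ) + 1) * |f s|)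
    (by positivity) (by push_cast; nlinarith)
  have h2 : ∀ i : ℕ, (truncatedSign f (((m : ℝ) + 1)⁻¹ * (i + 1)) s : ℝ) =
      (SignType.sign (f s) : ℝ) * if (i + 1 : ℝ) < ((m : ℝ) + 1) * |f s| then 1 else 0 := by
    intro i
    simp only [truncatedSign, inv_mul_lt_iff₀ hd]
    split_ifs <;> simp
  simp only [h2]
  rw [← Finset.mul_sum]
  set C : ℝ := ∑ i ∈ Finset.range ((m + 1) ^ 2),
    if (i + 1 : ℝ) < ((m : ℝ) + 1) * |f s| then (1 : ℝ) else 0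
  have h3 : ((m : ℝ) + 1)⁻¹ * ((SignType.sign (f s) : ℝ) * C) - f s =
      (SignType.sign (f s) : ℝ) * (((m : ℝ) + 1)⁻¹ * (C - ((m : ℝ) + 1) * |f s|)) := by
    conv_lhs => rw [← sign_mul_abs (f s)]
    rw [sign_mul_abs]
    field_simp
    rw [mul_sub, ← mul_assoc, mul_comm _ ((m : ℝ) + 1), mul_assoc, sign_mul_abs]
  have h4 : |(SignType.sign (f s) : ℝ)| ≤ 1 := by
    rcases SignType.sign (f s) with _ | _ | _ <;> simp
  rw [Real.dist_eq, h3, abs_mul, abs_mul, abs_of_pos (inv_pos.2 hd), one_div]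
  calc _ ≤ 1 * (((m : ℝ) + 1)⁻¹ * 1) := by gcongr
    _ = _ := by ring

theorem sum_tailProb_le_mul {n : ℕ} {c : ℝ} (h : ∀ u, 0 < u → u ≤ 1 →
    ∑ j ∈ Finset.range n, ψ (tailProb n (j + 1) u) ≤ c * ψ u) {u : ℝ} (h0 : 0 ≤ u) (h1 : u ≤ 1) :
    ∑ j ∈ Finset.range n, ψ (tailProb n (j + 1) u) ≤ c * ψ u := by
  rcases h0.eq_or_lt with rfl | h0
  · rw [ψ.map_zero, mul_zero]
    refine Finset.sum_nonpos fun j _ => ?_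
    have : tailProb n (j + 1) 0 = 0 := le_antisymm
      ((tailProb_le_mul_pow n (j + 1) le_rfl zero_le_one).trans (by simp))
      (tailProb_nonneg le_rfl zero_le_one _ _)
    rw [this, ψ.map_zero]
  · exact h u h0 h1

/-- By the Fatou property `f` may be replaced by `δ ∑ h' i`. Each `|A_n (h' i)|` is an integer at
most `n`, hence equals the number of `j < n` with `j + 1 ≤ |A_n (h' i)|`; so the image is dominated
by `δ` times a count of events with known probabilities. -/
theorem lorentzNorm_operatorA_le {n : ℕ} {c : ℝ} (hc : 0 ≤ c) (h : ∀ u, 0 < u → u ≤ 1 →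
    ∑ j ∈ Finset.range n, ψ (tailProb n (j + 1) u) ≤ c * ψ u) {f : I → ℝ} (hf : Measurable f) :
    lorentzNorm ψ (volume : Measure (Fin n → I × I)) (operatorA n f) ≤
      ENNReal.ofReal c * lorentzNorm ψ (volume : Measure I) f := by
  classical
  refine lorentzNorm_le_of_tendsto ψ (y := fun m => operatorA n fun s =>
    ((m : ℝ) + 1)⁻¹ * ∑ i ∈ Finset.range ((m + 1) ^ 2),
      (truncatedSign f (((m : ℝ) + 1)⁻¹ * (i + 1)) s : ℝ)) (fun ω => ?_) fun m => ?_
  · exact tendsto_finsetSum _ fun i _ => (tendsto_sum_truncatedSign f _).mul_const _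
  set δ : ℝ := ((m : ℝ) + 1)⁻¹ with hδdef
  have hδ : 0 < δ := by positivity
  set K := (m + 1) ^ 2
  set h' : ℕ → I → SignType := fun i => truncatedSign f (δ * (i + 1)) with hh'
  have hm : ∀ i a, MeasurableSet (h' i ⁻¹' {a}) := fun i a =>
    measurableSet_truncatedSign_preimage hf _ a
  set u : ℕ → ℝ := fun i => (volume : Measure I).real {s | δ * (i + 1) < |f s|} with hu
  have hu' : ∀ i, (volume : Measure I).real {s | h' i s ≠ 0} = u i := fun i => by
    rw [hh', setOf_truncatedSign_ne_zero f (by positivity)]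
  have hlin : ∀ ω, operatorA n (fun s => δ * ∑ i ∈ Finset.range K, (h' i s : ℝ)) ω =
      δ * ∑ i ∈ Finset.range K, operatorA n (fun s => (h' i s : ℝ)) ω := by
    intro ω
    unfold operatorA
    rw [Finset.sum_comm, Finset.mul_sum]
    simp only [Finset.sum_mul, mul_assoc]
  have hbound := lorentzNorm_le_of_abs_le_card ψ (P := (volume : Measure (Fin n → I × I)))
    (x := operatorA n (fun s => δ * ∑ i ∈ Finset.range K, (h' i s : ℝ)))
    (Finset.range K ×ˢ Finset.range n)
    (fun p => {ω | ((p.2 + 1 : ℕ) : ℝ) ≤ |operatorA n (fun s => (h' p.1 s : ℝ)) ω|})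
    (fun p _ => (measureReal_le_abs_operatorA_sign (hm p.1) (p.2 + 1)).1) hδ ?_
  · refine hbound.trans ?_
    rw [Finset.sum_product]
    simp only [fun i j => (measureReal_le_abs_operatorA_sign (n := n) (hm i) (j + 1)).2, hu']
    have h1 : ∑ i ∈ Finset.range K, ∑ j ∈ Finset.range n, ψ (tailProb n (j + 1) (u i)) ≤
        c * ∑ i ∈ Finset.range K, ψ (u i) := by
      rw [Finset.mul_sum]
      exact Finset.sum_le_sum fun i _ =>
        sum_tailProb_le_mul ψ h measureReal_nonneg measureReal_le_one
    refine (ENNReal.ofReal_le_ofReal (mul_le_mul_of_nonneg_left h1 hδ.le)).trans ?_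
    rw [mul_left_comm, ENNReal.ofReal_mul hc]
    gcongr
    rw [lorentzNorm_eq, mul_comm, ENNReal.ofReal_mul
      (Finset.sum_nonneg fun i _ => ψ.nonneg measureReal_nonneg measureReal_le_one),
      ENNReal.ofReal_sum_of_nonneg
        fun i _ => ψ.nonneg measureReal_nonneg measureReal_le_one, Finset.sum_mul]
    -- The levels `δ (i + 1)` are right endpoints, so for a decreasing integrand this is a lower
    -- Riemann sum.
    refine (le_lintegral_Ico_mul hδ.le K _ fun i _ s hs => ?_).trans
      (lintegral_mono_set Ico_subset_Ici_self)
    exact antitone_ofReal_map_measure ψ f hs.2.le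
  · intro ω
    rw [hlin, abs_mul, abs_of_pos hδ]
    refine mul_le_mul_of_nonneg_left ((Finset.abs_sum_le_sum_abs _ _).trans ?_) hδ.le
    rw [Finset.card_filter, Finset.sum_product]
    push_cast
    refine Finset.sum_le_sum fun i _ => ?_
    simp only [abs_operatorA_sign, mem_ofPred_eq]
    set N := (∑ k, ((h' i (ω k).1 *
      (if ((ω k).2 : ℝ) ≤ 1 / 2 then 1 else -1) : SignType) : ℤ)).natAbs with hN
    have hNn : N ≤ n := by
      refine (SignType.natAbs_sum_le _).trans
        ((Finset.sum_le_sum fun i _ => SignType.natAbs_coe_le_one _).trans ?_)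
      simp
    rw [← Finset.sum_filter, Finset.sum_const, nsmul_one]
    have : Finset.filter (fun j : ℕ => (j : ℝ) + 1 ≤ (N : ℝ)) (Finset.range n) =
        Finset.range N := by
      ext j
      have : ((j : ℝ) + 1 ≤ (N : ℝ)) ↔ j + 1 ≤ N := by exact_mod_cast Iff.rfl
      simp only [Finset.mem_filter, Finset.mem_range, this]
      omega
    rw [this, Finset.card_range]

theorem operatorANorm_le {n : ℕ} {c : ℝ} (hc : 0 ≤ c) (h : ∀ u, 0 < u → u ≤ 1 →
    ∑ j ∈ Finset.range n, ψ (tailProb n (j + 1) u) ≤ c * ψ u) :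
    operatorANorm ψ n ≤ ENNReal.ofReal c := by
  refine sInf_le fun f hf => ?_
  obtain ⟨g, hg, hae⟩ := hf.1
  have hA : operatorA n f =ᵐ[volume] operatorA n (g) := by
    have : ∀ᵐ ω : Fin n → I × I, ∀ i, f (ω i).1 = g (ω i).1 := by
      rw [ae_all_iff]
      intro i
      have h1 : ∀ᵐ p : I × I, f p.1 = g p.1 :=
        Measure.quasiMeasurePreserving_fst.ae hae
      exact (measurePreserving_eval (fun _ : Fin n => (volume : Measure (I × I))) i).quasiMeasurePreserving.ae h1
    filter_upwards [this] with ω hω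
    simp only [operatorA, hω]
  rw [lorentzNorm_congr ψ hA, lorentzNorm_congr ψ hae]
  exact lorentzNorm_operatorA_le ψ hc h hg

end reduction

/-! ### Strict inequality at fixed `u`, and behaviour as `u → 0`. -/

namespace PsiClass

variable (ψ : PsiClass)

/-- Jensen bounds the sum by `n * ψ M`, where the mean tail `M` is below `u`. If `ψ M = ψ u`,
concavity makes `ψ` constant from `M` on, so `ψ u = ψ 1`; then the last tail, at most `2 * (1 / 2) ^
n`, gives a strictly smaller term. -/
theorem sum_map_tailProb_lt {n : ℕ} (hn : 2 ≤ n) {a : ℝ} (ha : a ≤ 1)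
    (haψ : ψ a < ψ 1) (hna : 2 * (1 / 2 : ℝ) ^ n ≤ a) {u : ℝ} (h0 : 0 < u) (h1 : u ≤ 1) :
    ∑ j ∈ Finset.range n, ψ (tailProb n (j + 1) u) < n * ψ u := by
  have hn0 : (0 : ℝ) < n := by positivity
  have hp0 : ∀ j, 0 ≤ tailProb n j u := tailProb_nonneg h0.le h1 n
  have hp1 : ∀ j, tailProb n j u ≤ 1 := tailProb_le_one h0.le h1 n
  set M : ℝ := (∑ j ∈ Finset.range n, tailProb n (j + 1) u) / n with hM
  have hM0 : 0 ≤ M := div_nonneg (Finset.sum_nonneg fun j _ => hp0 _) hn0.le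
  have hMu : M < u := by
    rw [hM, div_lt_iff₀ hn0, mul_comm]
    exact sum_tailProb_lt hn h0 h1
  have hJ : ∑ j ∈ Finset.range n, ψ (tailProb n (j + 1) u) ≤ n * ψ M := by
    have := ψ.concaveOn.le_map_sum (t := Finset.range n) (w := fun _ => (n : ℝ)⁻¹)
      (p := fun j => tailProb n (j + 1) u) (fun _ _ => by positivity)
      (by simp [hn0.ne']) (fun j _ => ⟨hp0 _, hp1 _⟩)
    simp only [smul_eq_mul, ← Finset.mul_sum] at this
    rw [inv_mul_le_iff₀ hn0] at this
    rwa [hM, div_eq_inv_mul]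
  rcases (ψ.mono hM0 hMu.le h1).lt_or_eq with hlt | heq
  · exact hJ.trans_lt (mul_lt_mul_of_pos_left hlt hn0)
  · have hu1 : ψ u = ψ 1 := by
      refine le_antisymm (ψ.mono h0.le h1 le_rfl) ?_
      rcases h1.eq_or_lt with rfl | h1
      · exact le_rfl
      have h1M : 0 < 1 - M := by linarith
      have := ψ.concaveOn.2 ⟨hM0, hMu.le.trans h1.le⟩ ⟨zero_le_one, le_rfl⟩
        (div_nonneg (sub_nonneg.2 h1.le) h1M.le) (div_nonneg (sub_nonneg.2 hMu.le) h1M.le)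
        (by field_simp; ring)
      simp only [smul_eq_mul] at this
      have e : (1 - u) / (1 - M) * M + (u - M) / (1 - M) * 1 = u := by
        field_simp
        ring
      rw [e, heq] at this
      have e' : (1 - u) / (1 - M) * ψ u + (u - M) / (1 - M) * ψ 1 =
        ψ u + (u - M) / (1 - M) * (ψ 1 - ψ u) := by
        field_simp
        ring
      have hpos : 0 < (u - M) / (1 - M) := div_pos (by linarith) h1M
      rw [e'] at this
      nlinarith
    have hn1 : ψ (tailProb n n u) < ψ u := by
      rw [hu1]
      refine lt_of_le_of_lt (ψ.mono (hp0 n) ?_ ha) haψ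
      refine (tailProb_self_le n h0.le h1).trans (le_trans ?_ hna)
      gcongr
    obtain ⟨m, rfl⟩ : ∃ m, n = m + 1 := ⟨n - 1, by omega⟩
    calc _ < ∑ j ∈ Finset.range (m + 1), ψ u := by
          refine Finset.sum_lt_sum (fun j _ => ?_) ⟨m, by simp, hn1⟩
          rw [hu1]
          exact ψ.mono (hp0 _) (hp1 _) le_rfl
      _ = _ := by simp

theorem exists_map_lt_map_one : ∃ a, 0 < a ∧ a ≤ 1 ∧ ψ a < ψ 1 := by
  have h : Tendsto ψ (𝓝[Icc 0 1] 0) (𝓝 0) := by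
    have := ψ.continuousOn 0 ⟨le_rfl, zero_le_one⟩
    rwa [ContinuousWithinAt, ψ.map_zero] at this
  have h' : Tendsto ψ (𝓝[>] 0) (𝓝 0) :=
    h.mono_left (nhdsWithin_le_iff.2
      (mem_of_superset (Ioo_mem_nhdsGT one_pos) Ioo_subset_Icc_self))
  obtain ⟨a, h1, h2⟩ :=
    ((h'.eventually_lt_const ψ.map_one_pos).and (Ioo_mem_nhdsGT (one_pos (α := ℝ)))).exists
  exact ⟨a, h2.1, h2.2.le, h1⟩

theorem eventually_map_pow_mul_le {k : ℕ} (hk : 0 < k) {a : ℝ} (ha : 0 ≤ a)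
    (h : ∀ᶠ u in 𝓝[>] (0 : ℝ), ψ (k * u) ≤ a * ψ u) (m : ℕ) :
    ∀ᶠ u in 𝓝[>] (0 : ℝ), ψ (k ^ m * u) ≤ a ^ m * ψ u := by
  induction m with
  | zero => simp
  | succ m ih =>
    have ht : Tendsto (fun u : ℝ => (k : ℝ) ^ m * u) (𝓝[>] 0) (𝓝[>] 0) := by
      refine tendsto_nhdsWithin_iff.2 ⟨?_, ?_⟩
      · have : Tendsto (fun u : ℝ => (k : ℝ) ^ m * u) (𝓝 0) (𝓝 ((k : ℝ) ^ m * 0)) :=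
          (continuous_const_mul _).tendsto 0
        rw [mul_zero] at this
        exact this.mono_left nhdsWithin_le_nhds
      · filter_upwards [self_mem_nhdsWithin] with u hu
        have hu : (0 : ℝ) < u := hu
        exact mem_Ioi.2 (by positivity)
    filter_upwards [ih, ht.eventually h] with u h1 h2
    calc ψ (k ^ (m + 1) * u) = ψ (k * (k ^ m * u)) := by ring_nf
      _ ≤ a * ψ (k ^ m * u) := h2
      _ ≤ a * (a ^ m * ψ u) := by gcongr
      _ = _ := by ring

theorem eventually_operatorANorm_lt {k l : ℕ} (hk : 2 ≤ k) (hl : 2 ≤ l) {a b : ℝ} (ha : 0 ≤ a)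
    (hak : a < k) (hb : 0 ≤ b) (hb1 : b < 1)
    (h1 : ∀ᶠ u in 𝓝[>] (0 : ℝ), ψ (k * u) ≤ a * ψ u)
    (h2 : ∀ᶠ u in 𝓝[>] (0 : ℝ), ψ (u ^ l) ≤ b * ψ u) :
    ∀ᶠ n : ℕ in atTop, operatorANorm ψ n < (n : ℝ≥0∞) := by
  have hk0 : (0 : ℝ) < k := by positivity
  set η := 1 - b with hη
  have hη0 : 0 < η := by linarith
  -- Iterating the dilation condition `m` times makes the gain `(a / k) ^ m` smaller than `η / 2`.
  obtain ⟨m, hm⟩ := exists_pow_lt_of_lt_one (half_pos hη0) ((div_lt_one hk0).2 hak)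
  obtain ⟨d, hd0, hd1, hdψ⟩ := ψ.exists_map_lt_map_one
  obtain ⟨N, hN⟩ := exists_nat_gt (2 * l / η)
  have hpow : ∀ᶠ n : ℕ in atTop, 2 * (1 / 2 : ℝ) ^ n ≤ d := by
    have : Tendsto (fun n : ℕ => 2 * (1 / 2 : ℝ) ^ n) atTop (𝓝 (2 * 0)) :=
      (tendsto_pow_atTop_nhds_zero_of_lt_one (by norm_num) (by norm_num)).const_mul 2
    rw [mul_zero] at this
    exact (this.eventually_lt_const hd0).mono fun _ h => h.le
  filter_upwards [hpow, eventually_ge_atTop 2, eventually_ge_atTop N,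
    eventually_ge_atTop (k ^ m)] with n hnd hn2 hnN hnk
  have hn0 : (0 : ℝ) < n := by positivity
  -- Budget near zero: `n * (η / 2)` for the first tail, `1` for each index below `l`, and `b` for
  -- every index. This is `n - n * (η / 2) + l`, below `n` as soon as `n > 2 * l / η`.
  set c₁ : ℝ := n * (η / 2) + l + n * b with hc₁
  have hc₁n : c₁ < n := by
    have : 2 * l / η < n := hN.trans_le (by exact_mod_cast hnN)
    rw [div_lt_iff₀ hη0] at this
    have : (n : ℝ) * b = n - n * η := by rw [hη]; ring
    rw [hc₁, this]
    linarith
  have hsmall : ∀ᶠ u in 𝓝[>] (0 : ℝ),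
      ∑ j ∈ Finset.range n, ψ (tailProb n (j + 1) u) ≤ c₁ * ψ u := by
    have hn3 : (0 : ℝ) < 1 / 3 ^ n := by positivity
    filter_upwards [ψ.eventually_map_pow_mul_le (by omega) ha h1 m, h2, Ioo_mem_nhdsGT hn3,
      Ioo_mem_nhdsGT (show (0 : ℝ) < 1 / n by positivity),
      Ioo_mem_nhdsGT (one_pos (α := ℝ))] with u hu1 hu2 hu3 hun hu
    have hu0 := hu.1
    have h3 : 3 ^ n * u ≤ 1 := by
      have := (lt_div_iff₀ (by positivity)).1 hu3.2
      linarith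
    have hnu : (n : ℝ) * u ≤ 1 := by
      have := (lt_div_iff₀ hn0).1 hun.2
      linarith
    have hψ := ψ.nonneg hu0.le hu.2.le
    have hp0 : ∀ j, 0 ≤ tailProb n j u := tailProb_nonneg hu0.le hu.2.le n
    have hψn : ψ (n * u) ≤ n * (η / 2) * ψ u := by
      have hkm : (0 : ℝ) < k ^ m := by positivity
      have e : (n : ℝ) * u = n / k ^ m * (k ^ m * u) := by field_simp
      have h5 := ψ.map_mul_le_mul (a := n / k ^ m) (t := k ^ m * u)
        ((one_le_div hkm).2 (by exact_mod_cast hnk)) (by positivity) (e ▸ hnu)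
      rw [← e] at h5
      calc _ ≤ _ := h5
        _ ≤ n / k ^ m * (a ^ m * ψ u) := by gcongr
        _ = n * (a / k) ^ m * ψ u := by rw [div_pow]; ring
        _ ≤ _ := by gcongr
    have hterm : ∀ j ∈ Finset.range n, ψ (tailProb n (j + 1) u) ≤
        ((if j = 0 then n * (η / 2) else 0) + (if j < l then 1 else 0) + b) * ψ u := by
      intro j hj
      rcases Nat.eq_zero_or_pos j with rfl | hj0
      · have hle : tailProb n (0 + 1) u ≤ n * u :=
          (Finset.single_le_sum (f := fun j => tailProb n (j + 1) u) (fun j _ => hp0 _) hj).trans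
            (sum_tailProb_lt hn2 hu0 hu.2.le).le
        refine ((ψ.mono (hp0 _) hle hnu).trans hψn).trans ?_
        refine mul_le_mul_of_nonneg_right ?_ hψ
        rw [if_pos rfl, if_pos (by omega)]
        linarith
      -- One power of `u` is spent on absorbing `3 ^ n`.
      · have hpow : ∀ i, i ≤ j → tailProb n (j + 1) u ≤ u ^ i := by
          intro i hi
          calc _ ≤ 3 ^ n * u ^ (j + 1) := tailProb_le_mul_pow _ _ hu0.le hu.2.le
            _ ≤ 3 ^ n * u ^ (i + 1) := by
                gcongr ?_ * ?_
                exact pow_le_pow_of_le_one hu0.le hu.2.le (by omega)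
            _ = (3 ^ n * u) * u ^ i := by ring
            _ ≤ 1 * u ^ i := by gcongr
            _ = _ := one_mul _
        rw [if_neg hj0.ne', zero_add]
        split_ifs with hjl
        · have h6 := ψ.mono (hp0 _) ((hpow 1 hj0).trans_eq (pow_one u)) hu.2.le
          nlinarith
        · refine (ψ.mono (hp0 _) (hpow l (by omega)) (pow_le_one₀ hu0.le hu.2.le)).trans ?_
          rwa [zero_add]
    refine (Finset.sum_le_sum hterm).trans ?_
    rw [← Finset.sum_mul]
    refine mul_le_mul_of_nonneg_right ?_ hψ
    rw [Finset.sum_add_distrib, Finset.sum_add_distrib, Finset.sum_const, Finset.card_range,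
      nsmul_eq_mul, ← Finset.sum_filter, ← Finset.sum_filter, Finset.sum_const, Finset.sum_const,
      nsmul_eq_mul, nsmul_eq_mul, mul_one]
    have c1 : ((Finset.filter (fun j => j = 0) (Finset.range n)).card : ℝ) ≤ 1 := by
      have : (Finset.filter (fun j => j = 0) (Finset.range n)) ⊆ {0} := fun j hj => by
        simpa using (Finset.mem_filter.1 hj).2
      exact_mod_cast Finset.card_le_card this
    have c2 : ((Finset.filter (fun j => j < l) (Finset.range n)).card : ℝ) ≤ l := by
      have : (Finset.filter (fun j => j < l) (Finset.range n)) ⊆ Finset.range l := fun j hj => by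
        simpa using (Finset.mem_filter.1 hj).2
      exact_mod_cast (Finset.card_le_card this).trans_eq (Finset.card_range l)
    have c3 : 0 ≤ n * (η / 2) := by positivity
    nlinarith
  obtain ⟨u₁, hu₁, hsmall⟩ := mem_nhdsGT_iff_exists_Ioo_subset.1 hsmall
  have hu₁0 : (0 : ℝ) < u₁ := hu₁
  -- Away from zero the ratio is continuous on a compact interval, so its pointwise bound `< n`
  -- becomes uniform.
  have hcomp : IsCompact (Icc (min u₁ 1) 1) := isCompact_Icc
  have hpos : ∀ u ∈ Icc (min u₁ 1) 1, 0 < u := fun u hu => (lt_min hu₁0 one_pos).trans_le hu.1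
  have hcont : ContinuousOn
      (fun u => (∑ j ∈ Finset.range n, ψ (tailProb n (j + 1) u)) / ψ u) (Icc (min u₁ 1) 1) := by
    refine ContinuousOn.div (continuousOn_finsetSum _ fun j _ => ?_) ?_ ?_
    · exact ψ.continuousOn.comp (continuous_tailProb n (j + 1)).continuousOn fun u hu =>
        ⟨tailProb_nonneg (hpos u hu).le hu.2 _ _, tailProb_le_one (hpos u hu).le hu.2 _ _⟩
    · exact ψ.continuousOn.mono fun u hu => ⟨(hpos u hu).le, hu.2⟩
    · exact fun u hu => (ψ.pos (hpos u hu) hu.2).ne'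
  obtain ⟨v, hv, hmax⟩ := hcomp.exists_isMaxOn ⟨1, min_le_right _ _, le_rfl⟩ hcont
  set c₂ : ℝ := (∑ j ∈ Finset.range n, ψ (tailProb n (j + 1) v)) / ψ v with hc₂
  have hc₂n : c₂ < n := by
    rw [hc₂, div_lt_iff₀ (ψ.pos (hpos v hv) hv.2)]
    exact ψ.sum_map_tailProb_lt hn2 hd1 hdψ hnd (hpos v hv) hv.2
  have hc0 : 0 ≤ max c₁ c₂ := le_max_of_le_left (by positivity)
  refine (operatorANorm_le ψ hc0 fun u h0 h1 => ?_).trans_lt ?_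
  · rcases lt_or_ge u u₁ with hlt | hge
    · refine (hsmall ⟨h0, hlt⟩ : _ ≤ _).trans ?_
      exact mul_le_mul_of_nonneg_right (le_max_left _ _) (ψ.nonneg h0.le h1)
    · have : _ ≤ c₂ := hmax (⟨min_le_of_left_le hge, h1⟩ : u ∈ Icc (min u₁ 1) 1)
      refine (div_le_iff₀ (ψ.pos h0 h1)).1 (this.trans (le_max_right _ _))
  · rw [← ENNReal.ofReal_natCast n]
    exact (ENNReal.ofReal_lt_ofReal_iff hn0).2 (max_lt hc₁n hc₂n)

/-- Only the first tail is kept; it is at least `n u (1 - u) ^ (n - 1)`, and concavity takes the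
last factor out of `ψ`. The gap between `c` and `c'` absorbs that factor, which tends to `1`. -/
theorem eventually_map_mul_le_of_operatorANorm_lt {n : ℕ} (hn : 1 ≤ n)
    (h : operatorANorm ψ n < n) :
    ∃ c : ℝ, c < n ∧ ∀ᶠ u in 𝓝[>] (0 : ℝ), ψ (n * u) ≤ c * ψ u := by
  obtain ⟨c, hcn, hc⟩ := exists_lt_of_operatorANorm_lt ψ h
  obtain ⟨c', hcc', hc'n⟩ := exists_between hcn
  have hn0 : (0 : ℝ) < n := by positivity
  refine ⟨c', hc'n, ?_⟩
  have hlim : Tendsto (fun u : ℝ => c' * (1 - u) ^ (n - 1)) (𝓝[>] 0) (𝓝 c') := by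
    have : Tendsto (fun u : ℝ => c' * (1 - u) ^ (n - 1)) (𝓝 0) (𝓝 (c' * (1 - 0) ^ (n - 1))) :=
      (by fun_prop : Continuous fun u : ℝ => c' * (1 - u) ^ (n - 1)).tendsto 0
    rw [sub_zero, one_pow, mul_one] at this
    exact this.mono_left nhdsWithin_le_nhds
  filter_upwards [hlim.eventually_const_lt hcc', Ioo_mem_nhdsGT (one_pos (α := ℝ)),
    Ioo_mem_nhdsGT (show (0 : ℝ) < 1 / n by positivity)] with u hu hu1 hun
  have hnu : (n : ℝ) * u ≤ 1 := by
    have := (lt_div_iff₀ hn0).1 hun.2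
    linarith
  have hu0 := hu1.1
  have hp0 : ∀ j, 0 ≤ tailProb n j u := tailProb_nonneg hu1.1.le hu1.2.le n
  have hp1 : ∀ j, tailProb n j u ≤ 1 := tailProb_le_one hu1.1.le hu1.2.le n
  have hq : 0 < (1 - u) ^ (n - 1) := pow_pos (by linarith [hu1.2]) _
  have hq1 : (1 - u) ^ (n - 1) ≤ 1 := pow_le_one₀ (by linarith [hu1.2]) (by linarith)
  have key : (1 - u) ^ (n - 1) * ψ (n * u) ≤ (1 - u) ^ (n - 1) * (c' * ψ u) := by
    calc _ ≤ ψ ((1 - u) ^ (n - 1) * (n * u)) := ψ.mul_le_map_mul hq.le hq1 (by positivity) hnu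
      _ ≤ ψ (tailProb n (0 + 1) u) := by
        refine ψ.mono (by positivity) ?_ (hp1 _)
        rw [mul_comm]
        exact mul_one_sub_pow_le_tailProb n hu0.le hu1.2.le
      _ ≤ ∑ j ∈ Finset.range n, ψ (tailProb n (j + 1) u) :=
        Finset.single_le_sum (f := fun j => ψ (tailProb n (j + 1) u))
          (fun j _ => ψ.nonneg (hp0 _) (hp1 _)) (Finset.mem_range.2 hn)
      _ ≤ c * ψ u := hc u hu0 hu1.2.le
      _ ≤ (c' * (1 - u) ^ (n - 1)) * ψ u :=
        mul_le_mul_of_nonneg_right hu.le (ψ.nonneg hu0.le hu1.2.le)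
      _ = _ := by ring
  exact le_of_mul_le_mul_left key hq

/-- All `n` tails are at least `(u / 2) ^ n`, which exceeds `u ^ (n + 1)` once `u < (1 / 2) ^ n`. -/
theorem eventually_map_pow_le_of_operatorANorm_lt {n : ℕ} (hn : 1 ≤ n)
    (h : operatorANorm ψ n < n) :
    ∃ c : ℝ, c < 1 ∧ ∀ᶠ u in 𝓝[>] (0 : ℝ), ψ (u ^ (n + 1)) ≤ c * ψ u := by
  obtain ⟨c, hcn, hc⟩ := exists_lt_of_operatorANorm_lt ψ h
  have hn0 : (0 : ℝ) < n := by positivity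
  refine ⟨c / n, (div_lt_one hn0).2 hcn, ?_⟩
  filter_upwards [Ioo_mem_nhdsGT (one_pos (α := ℝ)),
    Ioo_mem_nhdsGT (show (0 : ℝ) < (1 / 2) ^ n by positivity)] with u hu hun
  have hu0 := hu.1
  have hle : u ^ (n + 1) ≤ (u / 2) ^ n := by
    calc u ^ (n + 1) = u ^ n * u := pow_succ _ _
      _ ≤ u ^ n * (1 / 2) ^ n := by gcongr; exact hun.2.le
      _ = _ := by rw [← mul_pow]; ring
  rw [div_mul_eq_mul_div, le_div_iff₀ hn0, mul_comm]
  refine le_trans ?_ (hc u hu0 hu.2.le)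
  calc (n : ℝ) * ψ (u ^ (n + 1)) = ∑ j ∈ Finset.range n, ψ (u ^ (n + 1)) := by simp
    _ ≤ _ := by
      refine Finset.sum_le_sum fun j hj => ψ.mono (by positivity) (hle.trans ?_)
        (tailProb_le_one hu0.le hu.2.le _ _)
      exact pow_le_tailProb (Finset.mem_range.1 hj) hu0.le hu.2.le

/-- The two hypotheses bound the quotient from below and above, without which a real `limsup` may be
a default value. -/
theorem limsup_div_lt_iff {g : ℝ → ℝ} {b : ℝ}
    (hg : ∀ᶠ u in 𝓝[>] (0 : ℝ), 0 ≤ ψ (g u))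
    (hb : ∃ B : ℝ, ∀ᶠ u in 𝓝[>] (0 : ℝ), ψ (g u) ≤ B * ψ u) :
    limsup (fun u => ψ (g u) / ψ u) (𝓝[>] (0 : ℝ)) < b ↔
      ∃ c < b, ∀ᶠ u in 𝓝[>] (0 : ℝ), ψ (g u) ≤ c * ψ u := by
  have hpos : ∀ᶠ u in 𝓝[>] (0 : ℝ), 0 < ψ u := by
    filter_upwards [Ioo_mem_nhdsGT (one_pos (α := ℝ))] with u hu
    exact ψ.pos hu.1 hu.2.le
  have hdiv : ∀ {c : ℝ}, (∀ᶠ u in 𝓝[>] (0 : ℝ), ψ (g u) ≤ c * ψ u) →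
      ∀ᶠ u in 𝓝[>] (0 : ℝ), ψ (g u) / ψ u ≤ c := fun h => by
    filter_upwards [h, hpos] with u h1 h2
    exact (div_le_iff₀ h2).2 h1
  constructor
  · intro h
    obtain ⟨B, hB⟩ := hb
    obtain ⟨c, hc, hcb⟩ := exists_between h
    refine ⟨c, hcb, ?_⟩
    filter_upwards [eventually_lt_of_limsup_lt hc ⟨B, hdiv hB⟩, hpos] with u h1 h2
    exact (div_le_iff₀ h2).1 h1.le
  · rintro ⟨c, hcb, hc⟩
    refine (limsup_le_of_le ?_ (hdiv hc)).trans_lt hcb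
    refine IsBoundedUnder.isCoboundedUnder_le ⟨0, ?_⟩
    refine eventually_map.2 ?_
    filter_upwards [hg, hpos] with u h1 h2
    exact div_nonneg h1 h2.le

theorem limsup_map_mul_div_lt_iff {k : ℕ} (hk : 1 ≤ k) {b : ℝ} :
    limsup (fun u : ℝ => ψ ((k : ℝ) * u) / ψ u) (𝓝[>] (0 : ℝ)) < b ↔
      ∃ c < b, ∀ᶠ u in 𝓝[>] (0 : ℝ), ψ (k * u) ≤ c * ψ u := by
  have hk0 : (0 : ℝ) < k := by positivity
  have hsmall : ∀ᶠ u in 𝓝[>] (0 : ℝ), 0 < u ∧ (k : ℝ) * u ≤ 1 := by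
    filter_upwards [Ioo_mem_nhdsGT (show (0 : ℝ) < 1 / k by positivity)] with u hu
    have := (lt_div_iff₀ hk0).1 hu.2
    exact ⟨hu.1, by linarith⟩
  refine ψ.limsup_div_lt_iff (hsmall.mono fun u hu => ψ.nonneg (mul_nonneg hk0.le hu.1.le) hu.2)
    ⟨k, hsmall.mono fun u hu => ψ.map_mul_le_mul (by exact_mod_cast hk) hu.1.le hu.2⟩

theorem limsup_map_pow_div_lt_iff {l : ℕ} (hl : 1 ≤ l) {b : ℝ} :
    limsup (fun u : ℝ => ψ (u ^ l) / ψ u) (𝓝[>] (0 : ℝ)) < b ↔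
      ∃ c < b, ∀ᶠ u in 𝓝[>] (0 : ℝ), ψ (u ^ l) ≤ c * ψ u := by
  have hsmall : ∀ᶠ u in 𝓝[>] (0 : ℝ), u ∈ Ioo (0 : ℝ) 1 := Ioo_mem_nhdsGT one_pos
  refine ψ.limsup_div_lt_iff (hsmall.mono fun u hu => ψ.nonneg (pow_nonneg hu.1.le _)
    (pow_le_one₀ hu.1.le hu.2.le)) ⟨1, hsmall.mono fun u hu => ?_⟩
  rw [one_mul]
  exact ψ.mono (pow_nonneg hu.1.le _) (pow_le_of_le_one hu.1.le hu.2.le (by omega)) hu.2.le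

end PsiClass

theorem mainTheorem2 (ψ : PsiClass) :
    (∀ᶠ n : ℕ in atTop, operatorANorm ψ n < (n : ℝ≥0∞)) ↔
      (∃ k : ℕ, 2 ≤ k ∧
        limsup (fun u : ℝ => ψ ((k : ℝ) * u) / ψ u) (𝓝[>] (0 : ℝ)) < (k : ℝ)) ∧
      (∃ l : ℕ, 2 ≤ l ∧
        limsup (fun u : ℝ => ψ (u ^ l) / ψ u) (𝓝[>] (0 : ℝ)) < 1) := by
  constructor
  · intro h
    -- A single `n ≥ 2` gives both conditions, with `k = n` and `l = n + 1`.
    obtain ⟨n, hn, hn2⟩ := (h.and (eventually_ge_atTop 2)).exists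
    refine ⟨⟨n, hn2, (ψ.limsup_map_mul_div_lt_iff (by omega)).2 ?_⟩,
      ⟨n + 1, by omega, (ψ.limsup_map_pow_div_lt_iff (by omega)).2 ?_⟩⟩
    · exact ψ.eventually_map_mul_le_of_operatorANorm_lt (by omega) hn
    · exact ψ.eventually_map_pow_le_of_operatorANorm_lt (by omega) hn
  · rintro ⟨⟨k, hk, hk'⟩, ⟨l, hl, hl'⟩⟩
    obtain ⟨a, ha, ha'⟩ := (ψ.limsup_map_mul_div_lt_iff (by omega)).1 hk'
    obtain ⟨b, hb, hb'⟩ := (ψ.limsup_map_pow_div_lt_iff (by omega)).1 hl'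
    have hpos : ∀ᶠ u in 𝓝[>] (0 : ℝ), 0 ≤ ψ u := by
      filter_upwards [Ioo_mem_nhdsGT (one_pos (α := ℝ))] with u hu
      exact ψ.nonneg hu.1.le hu.2.le
    refine ψ.eventually_operatorANorm_lt hk hl (le_max_right a 0)
      (max_lt ha (by positivity)) (le_max_right b 0) (max_lt hb one_pos) ?_ ?_
    · filter_upwards [ha', hpos] with u h1 h2
      exact h1.trans (mul_le_mul_of_nonneg_right (le_max_left _ _) h2)
    · filter_upwards [hb', hpos] with u h1 h2
      exact h1.trans (mul_le_mul_of_nonneg_right (le_max_left _ _) h2)
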